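/- \textbf{Theorem (Asymptotic normality of the Dirichlet kernel estimator).} Let $d\ge 1$, $\|s\|_1=\sum_{i=1}^d|s_i|$, $\mathcal S=\{s\in[0,1]^d:\|s\|_1\le 1\}$ and $\mathrm{Int}(\mathcal S)=\{s\in(0,1)^d:\|s\|_1<1\}$. For $\alpha_1,\dots,\alpha_d,\beta>0$ let $$K_{\alpha,\beta}(x)=\frac{\Gamma(\|\alpha\|_1+\beta)}{\Gamma(\beta)\prod_{i=1}^d\Gamma(\alpha_i)}\,(1-\|x\|_1)^{\beta-1}\prod_{i=1}^d x_i^{\alpha_i-1},\qquad x\in\mathcal S,$$ be the Dirichlet density. Let $X_1,X_2,\dots$ be i.i.d. random vectors with a density $f$ (with respect to Lebesgue measure) supported on $\mathcal S$, and for $b>0$, $n\ge 1$, $s\in\mathcal S$ put $$\hat f_{n,b}(s)=\frac1n\sum_{i=1}^nK_{s/b+1,\,(1-\|s\|_1)/b+1}(X_i),\qquad f_b(s)=\mathbb E\big[\hat f_{n,b}(s)\big].$$ Write $$\psi(s)=\Big[(4\pi)^d(1-\|s\|_1)\prod_{i=1}^ds_i\Big]^{-1/2}$$ and, when $f$ is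 $C^2$, $$g(s)=\sum_{i=1}^d(1-(d+1)s_i)\frac{\partial f}{\partial s_i}(s)+\frac12\sum_{i,j=1}^ds_i(\mathbf 1_{\{i=j\}}-s_j)\frac{\partial^2f}{\partial s_i\partial s_j}(s).$$ Let $s\in\mathrm{Int}(\mathcal S)$ with $f(s)>0$, and let $b=b(n)>0$ be a sequence of bandwidths. All limits are taken as $n\to\infty$, and $\xrightarrow{\mathscr D}$ is convergence in law. (i) If $f$ is Lipschitz continuous on $\mathcal S$, $b\to0$ and $n^{1/2}b^{d/4}\to\infty$, then $$n^{1/2}b^{d/4}\big(\hat f_{n,b}(s)-f_b(s)\big)\xrightarrow{\mathscr D}\mathcal N\big(0,\psi(s)f(s)\big).$$ (ii) If, in addition to the assumptions of (i), $n^{1/2}b^{d/4+1/2}\to0$, then $$n^{1/2}b^{d/4}\big(\hat f_{n,b}(s)-f(s)\big)\xrightarrow{\mathscr D}\mathcal N\big(0,\psi(s)f(s)\big).$$ (iii) Independently of the rates in (i) and (ii), if $f$ is twice continuously differentiable on $\mathcal S$ and $n^{2/(d+4)}b\to\lambda$ for some $\lambda>0$, then $$n^{2/(d+4)}\big(\hat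 f_{n,b}(s)-f(s)\big)\xrightarrow{\mathscr D}\mathcal N\big(\lambda g(s),\lambda^{-d/2}\psi(s)f(s)\big).$$ -/

import Mathlib

open MeasureTheory ProbabilityTheory Filter Topology

namespace DirichletKernel

noncomputable section

/-- The norm `‖s‖₁ = ∑ |sᵢ|` of a vector of `ℝᵈ`. -/
def l1Norm {d : ℕ} (s : Fin d → ℝ) : ℝ := ∑ i, |s i|

/-- The simplex `{s ∈ [0,1]ᵈ : ‖s‖₁ ≤ 1}`. -/
def simplex (d : ℕ) : Set (Fin d → ℝ) :=
  {s | (∀ i, s i ∈ Set.Icc (0 : ℝ) 1) ∧ l1Norm s ≤ 1}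

/-- The interior of the simplex, `{s ∈ (0,1)ᵈ : ‖s‖₁ < 1}`. -/
def simplexInterior (d : ℕ) : Set (Fin d → ℝ) :=
  {s | (∀ i, s i ∈ Set.Ioo (0 : ℝ) 1) ∧ l1Norm s < 1}

/-- The density `K_{α,β}` of the Dirichlet distribution with parameters `α₁, …, α_d, β > 0`, as a
function on the simplex (its values elsewhere play no role). -/
def dirichletDensity {d : ℕ} (α : Fin d → ℝ) (β : ℝ) (x : Fin d → ℝ) : ℝ :=
  Real.Gamma (l1Norm α + β) / (Real.Gamma β * ∏ i, Real.Gamma (α i)) *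
    ((1 - l1Norm x) ^ (β - 1) * ∏ i, x i ^ (α i - 1))

/-- The Dirichlet kernel at `s` with bandwidth `b`: the density `K_{s/b+1, (1-‖s‖₁)/b+1}`. -/
def kernel {d : ℕ} (b : ℝ) (s x : Fin d → ℝ) : ℝ :=
  dirichletDensity (fun i => s i / b + 1) ((1 - l1Norm s) / b + 1) x

/-- The Dirichlet kernel estimator `f̂_{n,b}(s)`, built from the first `n` observations of the
sequence `X 0, X 1, …`, as a random variable. -/
def estimator {d : ℕ} {Ω : Type*} (X : ℕ → Ω → Fin d → ℝ) (n : ℕ) (b : ℝ) (s : Fin d → ℝ)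
    (ω : Ω) : ℝ :=
  1 / (n : ℝ) * ∑ i ∈ Finset.range n, kernel b s (X i ω)

/-- The probability law on `ℝᵈ` carried by the simplex and having density `f` there. -/
def lawOfDensity {d : ℕ} (f : (Fin d → ℝ) → ℝ) : Measure (Fin d → ℝ) :=
  (volume.restrict (simplex d)).withDensity fun x => ENNReal.ofReal (f x)

/-- The function `ψ(s) = ((4π)ᵈ (1 - ‖s‖₁) ∏ sᵢ)^(-1/2)`. -/
def psi {d : ℕ} (s : Fin d → ℝ) : ℝ :=
  ((4 * Real.pi) ^ d * (1 - l1Norm s) * ∏ i, s i) ^ (-(1 / 2) : ℝ)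

/-- The partial derivative `∂f/∂sᵢ` on the simplex. In the interior this is the ordinary partial
derivative. -/
def partialDeriv {d : ℕ} (i : Fin d) (f : (Fin d → ℝ) → ℝ) (s : Fin d → ℝ) : ℝ :=
  fderivWithin ℝ f (simplex d) s (Pi.single i 1)

/-- The function
`g(s) = ∑ᵢ (1 - (d+1) sᵢ) ∂ᵢf(s) + ½ ∑ᵢⱼ sᵢ (1_{i=j} - sⱼ) ∂ᵢ∂ⱼf(s)`. -/
def biasTerm {d : ℕ} (f : (Fin d → ℝ) → ℝ) (s : Fin d → ℝ) : ℝ :=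
  ∑ i, (1 - ((d : ℝ) + 1) * s i) * partialDeriv i f s +
    1 / 2 * ∑ i, ∑ j, s i * ((if i = j then 1 else 0) - s j) *
      partialDeriv i (partialDeriv j f) s

end

end DirichletKernel

/-! The centred estimator is a sum of i.i.d. terms whose common law changes with `n`, so the proof
combines a triangular-array central limit theorem, the asymptotics of the second and fourth moments
of the kernel, and an expansion of the bias.

The central limit theorem `tendstoInDistribution_sum_add` is of Lyapunov type: convergence of `n`
times the second moment of a summand, and vanishing of `n` times the fourth, are enough for the
characteristic functions to converge to a Gaussian one.

The moments rest on an algebraic fact (`kernel_sq`): squaring the Dirichlet kernel of bandwidth `b`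
gives a constant `A_b` times the kernel of bandwidth `b/2`. Duplication and log-convexity of the
Gamma function show that `b^(d/2) A_b → ψ(s)`. Since the kernel is an approximate identity at `s`,
`b^(d/2) ∫ K_b² f` tends to `ψ(s) f(s)`. Iterating, `∫ K_b⁴ f` is of order at most `b^(-3d/2)`, so
the Lyapunov ratio is of order at most `1/(n b^(d/2))`.

For the bias, the polynomial moments of the kernel are explicit: the mean displacement and the
covariances are of order `b`, fourth central moments are `O(b²)`. A Lipschitz `f` thus has bias
`O(√b)`, and a `C²` function has bias `b g(s) + o(b)`, by integrating its Taylor polynomial. All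
three claims are instances of `tendstoInDistribution_estimator`, with different scalings and
centrings. -/

namespace DirichletKernel

/-! ### A central limit theorem for triangular arrays with i.i.d. rows -/

/-- The Taylor remainder is at most `4|u|³`, and `2|u|³ ≤ ηu² + u⁴/η` by the arithmetic-geometric
mean inequality. Trading the cube for even powers means that only second and fourth moments are ever
needed. -/
lemma norm_cexp_mul_I_sub_taylor_le (u : ℝ) {η : ℝ} (hη : 0 < η) :
    ‖Complex.exp (u * Complex.I) - (1 + u * Complex.I - u ^ 2 / 2)‖ ≤
      2 * (η * u ^ 2 + u ^ 4 / η) := by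
  have cube : ‖Complex.exp (u * Complex.I) - (1 + u * Complex.I - u ^ 2 / 2)‖ ≤ 4 * |u| ^ 3 := by
    rcases le_total |u| 1 with hu | hu
    · have h := Complex.exp_bound (x := u * Complex.I) (by simpa using hu) (n := 3) (by norm_num)
      have e : ∑ m ∈ Finset.range 3, (u * Complex.I) ^ m / (m.factorial : ℂ) =
          1 + u * Complex.I - u ^ 2 / 2 := by
        simp [Finset.sum_range_succ, Nat.factorial, mul_pow]
        ring
      rw [e] at h
      refine h.trans ?_
      have : ‖(u : ℂ) * Complex.I‖ = |u| := by simp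
      rw [this, mul_comm]
      gcongr
      norm_num [Nat.factorial]
    · calc _ ≤ ‖Complex.exp (u * Complex.I)‖ + (‖(1 : ℂ)‖ + ‖(u : ℂ) * Complex.I‖ +
            ‖(u : ℂ) ^ 2 / 2‖) := by
            refine (norm_sub_le _ _).trans ?_
            gcongr
            refine (norm_sub_le _ _).trans ?_
            gcongr
            exact norm_add_le _ _
        _ = 1 + (1 + |u| + |u| ^ 2 / 2) := by simp [Complex.norm_exp_ofReal_mul_I]
        _ ≤ 4 * |u| ^ 3 := by
            have h2 : |u| ≤ |u| ^ 3 := le_self_pow₀ hu (by norm_num)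
            have h3 : |u| ^ 2 ≤ |u| ^ 3 := pow_le_pow_right₀ hu (by norm_num)
            linarith
  refine cube.trans ?_
  have h : 2 * |u| ^ 3 ≤ η * u ^ 2 + u ^ 4 / η := by
    rw [← sq_abs u, ← Even.pow_abs (n := 4) (by decide) u]
    have : η * |u| ^ 2 + |u| ^ 4 / η - 2 * |u| ^ 3 = |u| ^ 2 * (η - |u|) ^ 2 / η := by
      field_simp
      ring
    have : 0 ≤ η * |u| ^ 2 + |u| ^ 4 / η - 2 * |u| ^ 3 := by rw [this]; positivity
    linarith
  linarith

lemma norm_integral_cexp_sub_le {E : Type*} [MeasurableSpace E] (Q : Measure E)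
    [IsProbabilityMeasure Q] {g : E → ℝ} (hg : Measurable g) (h0 : ∫ x, g x ∂Q = 0)
    (h4 : MemLp g 4 Q) (t : ℝ) {η : ℝ} (hη : 0 < η) :
    ‖∫ x, Complex.exp (t * g x * Complex.I) ∂Q - 1 + ((t ^ 2 / 2 * ∫ x, g x ^ 2 ∂Q : ℝ) : ℂ)‖ ≤
      2 * (η * (t ^ 2 * ∫ x, g x ^ 2 ∂Q) + t ^ 4 * (∫ x, g x ^ 4 ∂Q) / η) := by
  have i1 : Integrable g Q := (h4.mono_exponent (by norm_num)).integrable le_rfl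
  have i2 : Integrable (fun x => g x ^ 2) Q :=
    (h4.mono_exponent (p := 2) (by norm_num)).integrable_sq
  have i4 : Integrable (fun x => g x ^ 4) Q := by
    have := h4.integrable_norm_pow (p := 4) (by norm_num)
    simpa [Even.pow_abs (n := 4) (by decide)] using this
  have ie : Integrable (fun x => Complex.exp ((t * g x : ℝ) * Complex.I)) Q := by
    refine Integrable.of_bound (C := 1) (by fun_prop) (ae_of_all _ fun x => ?_)
    rw [Complex.norm_exp_ofReal_mul_I]
  have ip : Integrable (fun x => (1 : ℂ) + (t * g x : ℝ) * Complex.I - (t * g x : ℝ) ^ 2 / 2) Q := by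
    refine ((integrable_const _).add ((i1.const_mul t).ofReal.mul_const _)).sub ?_
    have := ((i2.const_mul (t ^ 2 / 2)).ofReal (𝕜 := ℂ))
    refine this.congr (ae_of_all _ fun x => ?_)
    simp
    ring
  have e : ∫ x, Complex.exp (t * g x * Complex.I) ∂Q - 1 +
      ((t ^ 2 / 2 * ∫ x, g x ^ 2 ∂Q : ℝ) : ℂ) =
      ∫ x, (Complex.exp ((t * g x : ℝ) * Complex.I) -
        (1 + (t * g x : ℝ) * Complex.I - (t * g x : ℝ) ^ 2 / 2)) ∂Q := by
    rw [integral_sub ie ip]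
    have : ∫ x, ((1 : ℂ) + (t * g x : ℝ) * Complex.I - (t * g x : ℝ) ^ 2 / 2) ∂Q =
        1 - ((t ^ 2 / 2 * ∫ x, g x ^ 2 ∂Q : ℝ) : ℂ) := by
      have e2 : ∀ x, (1 : ℂ) + (t * g x : ℝ) * Complex.I - (t * g x : ℝ) ^ 2 / 2 =
          1 + ((t * g x : ℝ) : ℂ) * Complex.I - ((t ^ 2 / 2 * g x ^ 2 : ℝ) : ℂ) := by
        intro x; push_cast; ring
      simp_rw [e2]
      rw [integral_sub, integral_add, integral_mul_const, integral_complex_ofReal,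
        integral_complex_ofReal, integral_const_mul, integral_const_mul, h0]
      · simp
      · exact integrable_const _
      · exact (i1.const_mul t).ofReal.mul_const _
      · exact (integrable_const _).add ((i1.const_mul t).ofReal.mul_const _)
      · exact (i2.const_mul _).ofReal
    rw [this]
    push_cast
    ring
  rw [e]
  refine (norm_integral_le_of_norm_le (g := fun x => 2 * (η * (t ^ 2 * g x ^ 2) +
    t ^ 4 * g x ^ 4 / η)) ?_ (ae_of_all _ fun x => ?_)).trans_eq ?_
  · exact (((i2.const_mul _).const_mul _).add ((i4.const_mul _).div_const _)).const_mul _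
  · refine (norm_cexp_mul_I_sub_taylor_le (t * g x) hη).trans_eq ?_
    ring
  · rw [integral_const_mul, integral_add ((i2.const_mul _).const_mul _)
      ((i4.const_mul _).div_const _), integral_const_mul, integral_const_mul, integral_div,
      integral_const_mul]

/-- With `φ_n` the characteristic function of one summand, `n(φ_n(t) - 1) → -t²v/2`, and `(1 +
z_n/n)^n → exp z` whenever `z_n → z`. -/
lemma tendsto_integral_cexp_pow {E : Type*} [MeasurableSpace E] (Q : Measure E)
    [IsProbabilityMeasure Q] {g : ℕ → E → ℝ} (hg : ∀ n, Measurable (g n))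
    (h0 : ∀ᶠ n in atTop, ∫ x, g n x ∂Q = 0) (h4 : ∀ᶠ n in atTop, MemLp (g n) 4 Q) {v : ℝ}
    (hv : Tendsto (fun n : ℕ => n * ∫ x, g n x ^ 2 ∂Q) atTop (𝓝 v))
    (hk : Tendsto (fun n : ℕ => n * ∫ x, g n x ^ 4 ∂Q) atTop (𝓝 0)) (t : ℝ) :
    Tendsto (fun n => (∫ x, Complex.exp (t * g n x * Complex.I) ∂Q) ^ n) atTop
      (𝓝 (Complex.exp ((-(t ^ 2 / 2 * v) : ℝ) : ℂ))) := by
  have key : Tendsto (fun n : ℕ => (n : ℂ) * (∫ x, Complex.exp (t * g n x * Complex.I) ∂Q - 1) +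
      ((t ^ 2 / 2 * (n * ∫ x, g n x ^ 2 ∂Q) : ℝ) : ℂ)) atTop (𝓝 0) := by
    set κ : ℕ → ℝ := fun n => n * ∫ x, g n x ^ 4 ∂Q with hκ
    set σ : ℕ → ℝ := fun n => n * ∫ x, g n x ^ 2 ∂Q with hσ
    have κ0 : ∀ n, 0 ≤ κ n := fun n =>
      mul_nonneg (Nat.cast_nonneg _) (integral_nonneg fun x => by positivity)
    have lim0 : Tendsto (fun n => √(κ n)) atTop (𝓝 0) := by
      simpa [Function.comp_def] using (Real.continuous_sqrt.tendsto 0).comp hk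
    have lim1 : Tendsto (fun n : ℕ => √(κ n) + 1 / ((n : ℝ) + 1)) atTop (𝓝 0) := by
      simpa using lim0.add tendsto_one_div_add_atTop_nhds_zero_nat
    -- The free parameter is `η = √κ_n + 1/(n+1)`: it tends to zero while `κ_n/η ≤ √κ_n` does too,
    -- and the second term keeps it positive when `κ_n = 0`.
    refine squeeze_zero_norm' (a := fun n : ℕ => 2 * ((√(κ n) + 1 / ((n : ℝ) + 1)) *
      (t ^ 2 * σ n) + t ^ 4 * √(κ n))) ?_ ?_
    · filter_upwards [h0, h4] with n h0 h4
      have η0 : 0 < √(κ n) + 1 / ((n : ℝ) + 1) := by positivity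
      have e : (n : ℂ) * (∫ x, Complex.exp (t * g n x * Complex.I) ∂Q - 1) +
          ((t ^ 2 / 2 * σ n : ℝ) : ℂ) = n * (∫ x, Complex.exp (t * g n x * Complex.I) ∂Q - 1 +
          ((t ^ 2 / 2 * ∫ x, g n x ^ 2 ∂Q : ℝ) : ℂ)) := by
        simp only [hσ]; push_cast; ring
      rw [e, norm_mul, Complex.norm_natCast]
      refine (mul_le_mul_of_nonneg_left (norm_integral_cexp_sub_le Q (hg n) h0 h4 t η0)
        (Nat.cast_nonneg _)).trans ?_
      have : κ n / (√(κ n) + 1 / ((n : ℝ) + 1)) ≤ √(κ n) := by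
        rw [div_le_iff₀ η0]
        nlinarith [Real.mul_self_sqrt (κ0 n), Real.sqrt_nonneg (κ n),
          mul_nonneg (Real.sqrt_nonneg (κ n)) (by positivity : 0 ≤ 1 / ((n : ℝ) + 1))]
      calc _ = 2 * ((√(κ n) + 1 / ((n : ℝ) + 1)) * (t ^ 2 * σ n) +
          t ^ 4 * (κ n / (√(κ n) + 1 / ((n : ℝ) + 1)))) := by simp only [hσ, hκ]; ring
        _ ≤ _ := by gcongr
    · simpa using ((lim1.mul (hv.const_mul (t ^ 2))).add (lim0.const_mul (t ^ 4))).const_mul 2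
  have h := Complex.tendsto_one_add_pow_exp_of_tendsto
    (g := fun n => ∫ x, Complex.exp (t * g n x * Complex.I) ∂Q - 1)
    (t := ((-(t ^ 2 / 2 * v) : ℝ) : ℂ)) (by
      have := key.sub ((Complex.continuous_ofReal.tendsto _).comp (hv.const_mul (t ^ 2 / 2)))
      simpa using this)
  simpa using h

/-- By Lévy's continuity theorem it suffices to treat characteristic functions. Independence turns
that of the sum into an `n`-th power, and the deterministic shift `m n`, which will carry the bias,
contributes a phase. -/
theorem tendstoInDistribution_sum_add {E Ω : Type*} [MeasurableSpace E] [MeasurableSpace Ω]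
    {P : Measure Ω} [IsProbabilityMeasure P] {Q : Measure E} [IsProbabilityMeasure Q]
    {X : ℕ → Ω → E} (hindep : iIndepFun X P) (hlaw : ∀ i, HasLaw (X i) Q P)
    {g : ℕ → E → ℝ} (hg : ∀ n, Measurable (g n))
    (h0 : ∀ᶠ n in atTop, ∫ x, g n x ∂Q = 0) (h4 : ∀ᶠ n in atTop, MemLp (g n) 4 Q) {v : ℝ}
    (hv : Tendsto (fun n : ℕ => n * ∫ x, g n x ^ 2 ∂Q) atTop (𝓝 v))
    (hk : Tendsto (fun n : ℕ => n * ∫ x, g n x ^ 4 ∂Q) atTop (𝓝 0))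
    {m : ℕ → ℝ} {m₀ : ℝ} (hm : Tendsto m atTop (𝓝 m₀)) :
    TendstoInDistribution (fun n ω => ∑ i ∈ Finset.range n, g n (X i ω) + m n) atTop
      (id : ℝ → ℝ) (fun _ => P) (gaussianReal m₀ v.toNNReal) := by
  have v0 : 0 ≤ v := ge_of_tendsto' hv fun n =>
    mul_nonneg (Nat.cast_nonneg _) (integral_nonneg fun x => by positivity)
  have aem : ∀ n i, AEMeasurable (fun ω => g n (X i ω)) P := fun n i =>
    (hg n).comp_aemeasurable (hlaw i).aemeasurable
  have aes : ∀ n, AEMeasurable (fun ω => ∑ i ∈ Finset.range n, g n (X i ω)) P := fun n =>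
    Finset.aemeasurable_fun_sum _ fun i _ => aem n i
  refine ⟨fun n => (aes n).add_const _, by fun_prop, ?_⟩
  refine ProbabilityMeasure.tendsto_iff_tendsto_charFun.2 fun t => ?_
  simp only [ProbabilityMeasure.coe_mk, Measure.map_id, charFun_gaussianReal]
  have one : ∀ n i, charFun (P.map fun ω => g n (X i ω)) t =
      ∫ x, Complex.exp (t * g n x * Complex.I) ∂Q := by
    intro n i
    rw [charFun_apply_real, integral_map (aem n i) (by fun_prop), ← (hlaw i).map_eq,
      integral_map (hlaw i).aemeasurable]
    have := hg n
    fun_prop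
  have cf : ∀ n, charFun (P.map fun ω => ∑ i ∈ Finset.range n, g n (X i ω) + m n) t =
      (∫ x, Complex.exp (t * g n x * Complex.I) ∂Q) ^ n * Complex.exp (t * m n * Complex.I) := by
    intro n
    have hprod := iIndepFun.charFun_map_fun_finsetSum_eq_prod (P := P) (s := Finset.range n)
      (X := fun i ω => g n (X i ω)) (fun i _ => aem n i)
      ((hindep.comp (fun _ => g n) fun _ => hg n).restrict _)
    have := congrFun hprod t
    simp only [Finset.prod_apply, one, Finset.prod_const, Finset.card_range] at this
    rw [← this, charFun_apply_real, charFun_apply_real, integral_map ((aes n).add_const _)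
      (by fun_prop), integral_map (aes n) (by fun_prop), ← integral_mul_const]
    congr 1 with ω
    rw [← Complex.exp_add]
    push_cast
    ring_nf
  simp_rw [cf]
  have lim := (tendsto_integral_cexp_pow Q hg h0 h4 hv hk t).mul
    (((Complex.continuous_exp.comp (by fun_prop : Continuous fun y : ℝ =>
      (t : ℂ) * y * Complex.I)).tendsto m₀).comp hm)
  have e : Complex.exp (t * m₀ * Complex.I - v.toNNReal * t ^ 2 / 2) =
      Complex.exp ((-(t ^ 2 / 2 * v) : ℝ) : ℂ) * Complex.exp (t * m₀ * Complex.I) := by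
    have : ((v.toNNReal : ℝ) : ℂ) = v := by rw [Real.coe_toNNReal v v0]
    rw [← Complex.exp_add, this]
    congr 1
    push_cast
    ring
  rw [e]
  exact lim

/-! ### The Dirichlet integral -/

variable {d : ℕ}

lemma l1Norm_of_nonneg {s : Fin d → ℝ} (h : ∀ i, 0 ≤ s i) : l1Norm s = ∑ i, s i :=
  Finset.sum_congr rfl fun i _ => abs_of_nonneg (h i)

lemma mem_simplex_iff {x : Fin d → ℝ} : x ∈ simplex d ↔ (∀ i, 0 ≤ x i) ∧ ∑ i, x i ≤ 1 := by
  constructor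
  · rintro ⟨h, h1⟩
    exact ⟨fun i => (h i).1, by rwa [l1Norm_of_nonneg fun i => (h i).1] at h1⟩
  · rintro ⟨h, h1⟩
    exact ⟨fun i => ⟨h i, (Finset.single_le_sum (fun j _ => h j) (Finset.mem_univ i)).trans h1⟩,
      by rwa [l1Norm_of_nonneg h]⟩

lemma mem_simplexInterior_iff {x : Fin d → ℝ} :
    x ∈ simplexInterior d ↔ (∀ i, 0 < x i) ∧ ∑ i, x i < 1 := by
  constructor
  · rintro ⟨h, h1⟩
    exact ⟨fun i => (h i).1, by rwa [l1Norm_of_nonneg fun i => (h i).1.le] at h1⟩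
  · rintro ⟨h, h1⟩
    exact ⟨fun i => ⟨h i, (Finset.single_le_sum (fun j _ => (h j).le)
      (Finset.mem_univ i)).trans_lt h1⟩, by rwa [l1Norm_of_nonneg fun i => (h i).le]⟩

lemma simplexInterior_subset : simplexInterior d ⊆ simplex d := fun x hx => by
  rw [mem_simplexInterior_iff] at hx
  exact mem_simplex_iff.2 ⟨fun i => (hx.1 i).le, hx.2.le⟩

lemma continuous_l1Norm : Continuous (l1Norm (d := d)) := by
  unfold l1Norm
  fun_prop

lemma simplexInterior_eq :
    simplexInterior d = (⋂ i, {x : Fin d → ℝ | 0 < x i}) ∩ {x | ∑ i, x i < 1} := by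
  ext x
  simp [mem_simplexInterior_iff]

lemma isOpen_simplexInterior : IsOpen (simplexInterior d) := by
  rw [simplexInterior_eq]
  exact (isOpen_iInter_of_finite fun i => isOpen_lt continuous_const (continuous_apply i)).inter
    (isOpen_lt (by fun_prop) continuous_const)

lemma isCompact_simplex : IsCompact (simplex d) := by
  have : simplex d = Set.pi Set.univ (fun _ => Set.Icc (0 : ℝ) 1) ∩ {x | l1Norm x ≤ 1} := by
    ext x
    simp only [simplex, Set.mem_ofPred_eq, Set.mem_inter_iff, Set.mem_univ_pi]
  rw [this]
  exact (isCompact_univ_pi fun _ => isCompact_Icc).inter_right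
    (isClosed_le continuous_l1Norm continuous_const)

lemma measurableSet_simplex : MeasurableSet (simplex d) := isCompact_simplex.isClosed.measurableSet

/-- The integrand of the Gamma integral, extended by zero to the negative half-line. -/
noncomputable def gammaIntegrand (a : ℝ) : ℝ → ℝ :=
  (Set.Ioi 0).indicator fun y => Real.exp (-y) * y ^ (a - 1)

lemma gammaIntegrand_nonneg (a y : ℝ) : 0 ≤ gammaIntegrand a y :=
  Set.indicator_nonneg (fun _ hy => mul_nonneg (Real.exp_pos _).le
    (Real.rpow_nonneg (le_of_lt hy) _)) y

lemma measurable_gammaIntegrand (a : ℝ) : Measurable (gammaIntegrand a) :=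
  Measurable.indicator (by fun_prop) measurableSet_Ioi

lemma integrable_gammaIntegrand {a : ℝ} (ha : 0 < a) : Integrable (gammaIntegrand a) :=
  (Real.GammaIntegral_convergent ha).integrable_indicator measurableSet_Ioi

lemma integral_gammaIntegrand {a : ℝ} (ha : 0 < a) : ∫ y, gammaIntegrand a y = Real.Gamma a := by
  rw [gammaIntegrand, integral_indicator measurableSet_Ioi, Real.Gamma_eq_integral ha]

lemma lintegral_gammaIntegrand {a : ℝ} (ha : 0 < a) :
    ∫⁻ y, ENNReal.ofReal (gammaIntegrand a y) = ENNReal.ofReal (Real.Gamma a) := by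
  rw [← integral_gammaIntegrand ha, ofReal_integral_eq_lintegral_ofReal
    (integrable_gammaIntegrand ha) (ae_of_all _ (gammaIntegrand_nonneg a))]

lemma lintegral_prod_gammaIntegrand {α : Fin d → ℝ} (hα : ∀ i, 0 < α i) :
    ∫⁻ x : Fin d → ℝ, ENNReal.ofReal (∏ i, gammaIntegrand (α i) (x i)) =
      ENNReal.ofReal (∏ i, Real.Gamma (α i)) := by
  simp_rw [← fun i => integral_gammaIntegrand (hα i)]
  rw [← integral_fintype_prod_volume_eq_prod fun i => gammaIntegrand (α i),
    ofReal_integral_eq_lintegral_ofReal]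
  · exact Integrable.fintype_prod fun i => integrable_gammaIntegrand (hα i)
  · exact ae_of_all _ fun x => Finset.prod_nonneg fun i _ => gammaIntegrand_nonneg _ _

/-- The unnormalised Dirichlet density, extended by zero outside of the open simplex. -/
noncomputable def dirichletIntegrand (α : Fin d → ℝ) (β : ℝ) : (Fin d → ℝ) → ℝ :=
  (simplexInterior d).indicator fun x => (1 - ∑ i, x i) ^ (β - 1) * ∏ i, x i ^ (α i - 1)

lemma measurable_dirichletIntegrand (α : Fin d → ℝ) (β : ℝ) :
    Measurable (dirichletIntegrand α β) := by
  refine Measurable.indicator ?_ isOpen_simplexInterior.measurableSet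
  fun_prop

lemma dirichletIntegrand_nonneg (α : Fin d → ℝ) (β : ℝ) (x : Fin d → ℝ) :
    0 ≤ dirichletIntegrand α β x := by
  refine Set.indicator_nonneg (fun x hx => ?_) x
  rw [mem_simplexInterior_iff] at hx
  exact mul_nonneg (Real.rpow_nonneg (by linarith) _)
    (Finset.prod_nonneg fun i _ => Real.rpow_nonneg (hx.1 i).le _)

/-- The joint density of independent Gamma variables factors into their total `t` and their
proportions `x`. Extension by zero makes both sides vanish together off the open simplex. -/
lemma prod_gammaIntegrand_smul (α : Fin d → ℝ) (β : ℝ) (x : Fin d → ℝ) {t : ℝ} (ht : 0 < t) :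
    (∏ i, gammaIntegrand (α i) (t * x i)) * gammaIntegrand β (t - ∑ i, t * x i) =
      (t ^ d)⁻¹ * (gammaIntegrand (∑ i, α i + β) t * dirichletIntegrand α β x) := by
  rw [← Finset.mul_sum]
  by_cases hx : x ∈ simplexInterior d
  · rw [dirichletIntegrand, Set.indicator_of_mem hx]
    rw [mem_simplexInterior_iff] at hx
    have h1 : 0 < 1 - ∑ i, x i := by linarith [hx.2]
    have h2 : t - t * ∑ i, x i = t * (1 - ∑ i, x i) := by ring
    have e1 : ∀ i, gammaIntegrand (α i) (t * x i) =
        t⁻¹ * (Real.exp (-(t * x i)) * (t ^ α i * x i ^ (α i - 1))) := by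
      intro i
      rw [gammaIntegrand, Set.indicator_of_mem (Set.mem_Ioi.2 (mul_pos ht (hx.1 i))),
        Real.mul_rpow ht.le (hx.1 i).le, Real.rpow_sub_one ht.ne']
      field_simp
    have e2 : gammaIntegrand β (t * (1 - ∑ i, x i)) =
        Real.exp (-(t * (1 - ∑ i, x i))) * (t ^ (β - 1) * (1 - ∑ i, x i) ^ (β - 1)) := by
      rw [gammaIntegrand, Set.indicator_of_mem (Set.mem_Ioi.2 (mul_pos ht h1)),
        Real.mul_rpow ht.le h1.le]
    have e3 : gammaIntegrand (∑ i, α i + β) t =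
        Real.exp (-t) * ((∏ i, t ^ α i) * t ^ (β - 1)) := by
      rw [gammaIntegrand, Set.indicator_of_mem (Set.mem_Ioi.2 ht),
        ← Real.rpow_sum_of_pos ht, ← Real.rpow_add ht]
      ring_nf
    have e4 : Real.exp (-t) = (∏ i, Real.exp (-(t * x i))) * Real.exp (-(t * (1 - ∑ i, x i))) := by
      rw [← Real.exp_sum, ← Real.exp_add, Finset.sum_neg_distrib, ← Finset.mul_sum]
      ring_nf
    rw [h2, e2, e3, e4]
    simp_rw [e1, Finset.prod_mul_distrib]
    simp
    ring
  · rw [dirichletIntegrand, Set.indicator_of_notMem hx, mul_zero, mul_zero]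
    rw [mem_simplexInterior_iff, not_and_or] at hx
    rcases hx with hx | hx
    · push Not at hx
      obtain ⟨i, hi⟩ := hx
      rw [Finset.prod_eq_zero (Finset.mem_univ i), zero_mul]
      rw [gammaIntegrand, Set.indicator_of_notMem]
      simpa using mul_nonpos_of_nonneg_of_nonpos ht.le hi
    · push Not at hx
      have : gammaIntegrand β (t - t * ∑ i, x i) = 0 := by
        rw [gammaIntegrand, Set.indicator_of_notMem]
        simp only [Set.mem_Ioi, not_lt]
        nlinarith
      rw [this, mul_zero]

lemma lintegral_comp_smul {g : (Fin d → ℝ) → ENNReal} (hg : Measurable g) {t : ℝ} (ht : 0 < t) :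
    ∫⁻ x, g x = ENNReal.ofReal (t ^ d) * ∫⁻ x, g (t • x) := by
  have h := Measure.map_addHaar_smul (volume : Measure (Fin d → ℝ)) ht.ne'
  have e : ∫⁻ x, g (t • x) = ENNReal.ofReal (t ^ d)⁻¹ * ∫⁻ x, g x := by
    rw [← lintegral_map hg (measurable_const_smul t), h, lintegral_smul_measure]
    simp [abs_of_pos ht]
  rw [e, ← mul_assoc, ← ENNReal.ofReal_mul (by positivity), mul_inv_cancel₀ (by positivity)]
  simp

lemma lintegral_prod_gammaIntegrand_mul (α : Fin d → ℝ) (β t : ℝ) :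
    ∫⁻ x : Fin d → ℝ, ENNReal.ofReal ((∏ i, gammaIntegrand (α i) (x i)) *
        gammaIntegrand β (t - ∑ i, x i)) =
      ENNReal.ofReal (gammaIntegrand (∑ i, α i + β) t) *
        ∫⁻ x, ENNReal.ofReal (dirichletIntegrand α β x) := by
  have meas : ∀ a, Measurable (gammaIntegrand a) := measurable_gammaIntegrand
  rcases lt_or_ge 0 t with ht | ht
  · rw [lintegral_comp_smul _ ht, ← lintegral_const_mul, ← lintegral_const_mul]
    · congr 1 with x
      rw [← ENNReal.ofReal_mul (by positivity), ← ENNReal.ofReal_mul (gammaIntegrand_nonneg _ _)]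
      simp only [Pi.smul_apply, smul_eq_mul]
      rw [prod_gammaIntegrand_smul α β x ht, mul_inv_cancel_left₀ (by positivity)]
    · have := measurable_dirichletIntegrand α β
      fun_prop
    · fun_prop
    · fun_prop
  · have z : gammaIntegrand (∑ i, α i + β) t = 0 := by
      rw [gammaIntegrand, Set.indicator_of_notMem (by simpa using ht)]
    rw [z]
    simp only [ENNReal.ofReal_zero, zero_mul]
    rw [lintegral_eq_zero_iff (by fun_prop)]
    refine ae_of_all _ fun x => ?_
    simp only [Pi.zero_apply, ENNReal.ofReal_eq_zero]
    refine le_of_eq ?_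
    by_cases hx : ∀ i, 0 < x i
    · have : gammaIntegrand β (t - ∑ i, x i) = 0 := by
        rw [gammaIntegrand, Set.indicator_of_notMem]
        have := Finset.sum_nonneg fun i (_ : i ∈ Finset.univ) => (hx i).le
        simp only [Set.mem_Ioi, not_lt]
        linarith
      rw [this, mul_zero]
    · push Not at hx
      obtain ⟨i, hi⟩ := hx
      rw [Finset.prod_eq_zero (Finset.mem_univ i), zero_mul]
      rw [gammaIntegrand, Set.indicator_of_notMem (by simpa using hi)]

/-- Integrate the factorised Gamma density over the total `t` and the coordinates. One order of
integration gives `Γ(∑ α + β)` times the Dirichlet integral; the other, after translating `t`, gives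
the product of Gamma values. Lower integrals make Tonelli free of integrability conditions. -/
theorem lintegral_dirichletIntegrand {α : Fin d → ℝ} {β : ℝ} (hα : ∀ i, 0 < α i) (hβ : 0 < β) :
    ∫⁻ x, ENNReal.ofReal (dirichletIntegrand α β x) =
      ENNReal.ofReal ((Real.Gamma β * ∏ i, Real.Gamma (α i)) / Real.Gamma (∑ i, α i + β)) := by
  have meas : ∀ a, Measurable (gammaIntegrand a) := measurable_gammaIntegrand
  have A0 : 0 < ∑ i, α i + β :=
    add_pos_of_nonneg_of_pos (Finset.sum_nonneg fun i _ => (hα i).le) hβ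
  have GA := Real.Gamma_pos_of_pos A0
  have key : ENNReal.ofReal (Real.Gamma (∑ i, α i + β)) *
      ∫⁻ x, ENNReal.ofReal (dirichletIntegrand α β x) =
      ENNReal.ofReal (Real.Gamma β * ∏ i, Real.Gamma (α i)) := by
    rw [← lintegral_gammaIntegrand A0, ← lintegral_mul_const _ (by fun_prop)]
    simp_rw [← lintegral_prod_gammaIntegrand_mul]
    rw [lintegral_lintegral_swap (by
      refine Measurable.aemeasurable ?_
      simp only [Function.uncurry_def]
      fun_prop)]
    have inner : ∀ x : Fin d → ℝ, ∫⁻ t, ENNReal.ofReal ((∏ i, gammaIntegrand (α i) (x i)) *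
        gammaIntegrand β (t - ∑ i, x i)) =
        ENNReal.ofReal (∏ i, gammaIntegrand (α i) (x i)) * ENNReal.ofReal (Real.Gamma β) := by
      intro x
      simp_rw [ENNReal.ofReal_mul (Finset.prod_nonneg fun i _ => gammaIntegrand_nonneg (α i) (x i))]
      rw [lintegral_const_mul _ (by fun_prop), lintegral_sub_right_eq_self
        (fun t => ENNReal.ofReal (gammaIntegrand β t)), lintegral_gammaIntegrand hβ]
    simp_rw [inner]
    rw [lintegral_mul_const _ (by fun_prop), lintegral_prod_gammaIntegrand hα, mul_comm,
      ENNReal.ofReal_mul (Real.Gamma_pos_of_pos hβ).le]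
  have ne0 : ENNReal.ofReal (Real.Gamma (∑ i, α i + β)) ≠ 0 := by simpa using GA
  rw [ENNReal.ofReal_div_of_pos GA, ← key]
  rw [mul_comm, ENNReal.mul_div_cancel_right ne0 ENNReal.ofReal_ne_top]

/-! ### The Dirichlet density -/

lemma continuous_dirichletDensity {α : Fin d → ℝ} {β : ℝ} (hα : ∀ i, 1 < α i) (hβ : 1 < β) :
    Continuous (dirichletDensity α β) := by
  unfold dirichletDensity
  refine continuous_const.mul (Continuous.mul ?_ (continuous_finsetProd _ fun i _ => ?_))
  · exact (continuous_const.sub continuous_l1Norm).rpow_const fun x => Or.inr (by linarith)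
  · exact (continuous_apply i).rpow_const fun x => Or.inr (by linarith [hα i])

lemma dirichletDensity_nonneg {α : Fin d → ℝ} {β : ℝ} (hα : ∀ i, 1 < α i) (hβ : 1 < β)
    {x : Fin d → ℝ} (hx : x ∈ simplex d) : 0 ≤ dirichletDensity α β x := by
  have g1 : 0 < Real.Gamma β := Real.Gamma_pos_of_pos (by linarith)
  have g2 : 0 < ∏ i, Real.Gamma (α i) :=
    Finset.prod_pos fun i _ => Real.Gamma_pos_of_pos (by linarith [hα i])
  have g3 : 0 < Real.Gamma (l1Norm α + β) := Real.Gamma_pos_of_pos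
    (add_pos_of_nonneg_of_pos (Finset.sum_nonneg fun i _ => abs_nonneg _) (by linarith))
  have g4 : 0 ≤ (1 - l1Norm x) ^ (β - 1) := Real.rpow_nonneg (by linarith [hx.2]) _
  have g5 : 0 ≤ ∏ i, x i ^ (α i - 1) :=
    Finset.prod_nonneg fun i _ => Real.rpow_nonneg (hx.1 i).1 _
  unfold dirichletDensity
  positivity

/-- Equality holds everywhere, boundary included, because all exponents are positive and so the
density vanishes on the faces. -/
lemma indicator_dirichletDensity {α : Fin d → ℝ} {β : ℝ} (hα : ∀ i, 1 < α i) (hβ : 1 < β)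
    (x : Fin d → ℝ) : (simplex d).indicator (dirichletDensity α β) x =
      Real.Gamma (∑ i, α i + β) / (Real.Gamma β * ∏ i, Real.Gamma (α i)) *
        dirichletIntegrand α β x := by
  by_cases hx : x ∈ simplexInterior d
  · have hx' := mem_simplexInterior_iff.1 hx
    rw [dirichletIntegrand, Set.indicator_of_mem hx,
      Set.indicator_of_mem (simplexInterior_subset hx), dirichletDensity,
      l1Norm_of_nonneg fun i => (hx'.1 i).le, l1Norm_of_nonneg fun i => by linarith [hα i]]
  · rw [dirichletIntegrand, Set.indicator_of_notMem hx, mul_zero]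
    by_cases hs : x ∈ simplex d
    · rw [Set.indicator_of_mem hs]
      have hs' := mem_simplex_iff.1 hs
      rw [mem_simplexInterior_iff, not_and_or] at hx
      rw [dirichletDensity, l1Norm_of_nonneg hs'.1]
      rcases hx with hx | hx
      · push Not at hx
        obtain ⟨i, hi⟩ := hx
        have : x i = 0 := le_antisymm hi (hs'.1 i)
        have z : ∏ i, x i ^ (α i - 1) = 0 := Finset.prod_eq_zero (Finset.mem_univ i) (by
          rw [this, Real.zero_rpow (by linarith [hα i])])
        rw [z, mul_zero, mul_zero]
      · have : 1 - ∑ i, x i = 0 := by linarith [hs'.2]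
        rw [this, Real.zero_rpow (by linarith), zero_mul, mul_zero]
    · rw [Set.indicator_of_notMem hs]

theorem integral_dirichletDensity {α : Fin d → ℝ} {β : ℝ} (hα : ∀ i, 1 < α i) (hβ : 1 < β) :
    ∫ x in simplex d, dirichletDensity α β x = 1 := by
  have α0 : ∀ i, 0 < α i := fun i => by linarith [hα i]
  have β0 : 0 < β := by linarith
  have A0 : 0 < ∑ i, α i + β :=
    add_pos_of_nonneg_of_pos (Finset.sum_nonneg fun i _ => (α0 i).le) β0
  have g1 := Real.Gamma_pos_of_pos β0
  have g2 : 0 < ∏ i, Real.Gamma (α i) := Finset.prod_pos fun i _ => Real.Gamma_pos_of_pos (α0 i)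
  have g3 := Real.Gamma_pos_of_pos A0
  rw [← integral_indicator measurableSet_simplex]
  simp_rw [indicator_dirichletDensity hα hβ]
  rw [integral_const_mul, integral_eq_lintegral_of_nonneg_ae
    (ae_of_all _ (dirichletIntegrand_nonneg α β))
    (measurable_dirichletIntegrand α β).aestronglyMeasurable, lintegral_dirichletIntegrand α0 β0,
    ENNReal.toReal_ofReal (by positivity)]
  field_simp

/-- Multiplying by `x i` raises the `i`-th parameter by one, and `Γ(z + 1) = zΓ(z)` accounts for the
constant. All polynomial moments follow by iteration. -/
lemma dirichletDensity_mul_apply {α : Fin d → ℝ} {β : ℝ} (hα : ∀ i, 1 < α i) (hβ : 1 < β)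
    {x : Fin d → ℝ} (hx : x ∈ simplex d) (i : Fin d) :
    dirichletDensity α β x * x i = α i / (∑ j, α j + β) *
      dirichletDensity (fun j => α j + if j = i then 1 else 0) β x := by
  have α0 : ∀ i, 0 < α i := fun i => by linarith [hα i]
  have β0 : 0 < β := by linarith
  have A0 : 0 < ∑ i, α i + β :=
    add_pos_of_nonneg_of_pos (Finset.sum_nonneg fun i _ => (α0 i).le) β0
  have g1 := Real.Gamma_pos_of_pos β0
  have g2 : 0 < ∏ i, Real.Gamma (α i) := Finset.prod_pos fun i _ => Real.Gamma_pos_of_pos (α0 i)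
  have α1 : ∀ j, 0 ≤ α j + if j = i then (1 : ℝ) else 0 := fun j => by
    split_ifs <;> linarith [α0 j]
  have eΓ : ∏ j, Real.Gamma (α j + if j = i then 1 else 0) = α i * ∏ j, Real.Gamma (α j) := by
    have : ∀ j, Real.Gamma (α j + if j = i then 1 else 0) =
        (if j = i then α j else 1) * Real.Gamma (α j) := by
      intro j
      split_ifs
      · rw [Real.Gamma_add_one (α0 j).ne']
      · simp
    simp_rw [this, Finset.prod_mul_distrib]
    simp
  have ex : ∏ j, x j ^ ((α j + if j = i then (1 : ℝ) else 0) - 1) =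
      x i * ∏ j, x j ^ (α j - 1) := by
    have : ∀ j, x j ^ ((α j + if j = i then (1 : ℝ) else 0) - 1) =
        (if j = i then x j else 1) * x j ^ (α j - 1) := by
      intro j
      split_ifs
      · have hj : 0 ≤ x j := (hx.1 j).1
        have e : α j + 1 - 1 = 1 + (α j - 1) := by ring
        rw [e, Real.rpow_add_of_nonneg hj zero_le_one (by linarith [hα j]), Real.rpow_one]
      · simp
    simp_rw [this, Finset.prod_mul_distrib]
    simp
  have eA : (∑ j, (α j + if j = i then (1 : ℝ) else 0)) + β = (∑ j, α j + β) + 1 := by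
    rw [Finset.sum_add_distrib]
    simp
    ring
  rw [dirichletDensity, dirichletDensity, l1Norm_of_nonneg fun j => (α0 j).le,
    l1Norm_of_nonneg α1, eA, Real.Gamma_add_one A0.ne', eΓ, ex]
  have := (α0 i).ne'
  field_simp

lemma integral_dirichletDensity_mul_apply_mul {α : Fin d → ℝ} {β : ℝ} (hα : ∀ i, 1 < α i)
    (hβ : 1 < β) (i : Fin d) (h : (Fin d → ℝ) → ℝ) :
    ∫ x in simplex d, dirichletDensity α β x * (x i * h x) = α i / (∑ j, α j + β) *
      ∫ x in simplex d, dirichletDensity (fun j => α j + if j = i then 1 else 0) β x * h x := by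
  rw [← integral_const_mul]
  refine setIntegral_congr_fun measurableSet_simplex fun x hx => ?_
  rw [← mul_assoc, dirichletDensity_mul_apply hα hβ hx i, mul_assoc]

lemma integral_dirichletDensity_mul_pow {α : Fin d → ℝ} {β : ℝ} (hα : ∀ i, 1 < α i)
    (hβ : 1 < β) (i : Fin d) (k : ℕ) :
    ∫ x in simplex d, dirichletDensity α β x * x i ^ k =
      ∏ j ∈ Finset.range k, ((α i + j) / (∑ l, α l + β + j)) := by
  induction k generalizing α with
  | zero => simpa using integral_dirichletDensity hα hβ
  | succ k ih =>
    have hα' : ∀ j, 1 < α j + if j = i then (1 : ℝ) else 0 := fun j => by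
      split_ifs <;> linarith [hα j]
    simp_rw [pow_succ', integral_dirichletDensity_mul_apply_mul hα hβ i fun x => x i ^ k]
    rw [ih hα', Finset.prod_range_succ', mul_comm]
    have e : ∑ l, (α l + if l = i then (1 : ℝ) else 0) = ∑ l, α l + 1 := by
      simp [Finset.sum_add_distrib]
    rw [e]
    congr 1
    · refine Finset.prod_congr rfl fun j _ => ?_
      push_cast
      simp only [if_true]
      ring_nf
    · simp

/-! ### Moments of the Dirichlet kernel -/

section Moments

variable {s : Fin d → ℝ} {b : ℝ}

lemma one_lt_kernel_param (hs : s ∈ simplexInterior d) (hb : 0 < b) (i : Fin d) :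
    1 < s i / b + 1 := by
  have := div_pos (hs.1 i).1 hb
  linarith

lemma one_lt_kernel_param_last (hs : s ∈ simplexInterior d) (hb : 0 < b) :
    1 < (1 - l1Norm s) / b + 1 := by
  have := div_pos (sub_pos.2 hs.2) hb
  linarith

lemma sum_kernel_param (hs : s ∈ simplexInterior d) :
    ∑ i, (s i / b + 1) + ((1 - l1Norm s) / b + 1) = 1 / b + (d + 1) := by
  rw [l1Norm_of_nonneg fun i => (hs.1 i).1.le, Finset.sum_add_distrib, ← Finset.sum_div]
  simp
  ring

lemma continuous_kernel (hs : s ∈ simplexInterior d) (hb : 0 < b) : Continuous (kernel b s) :=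
  continuous_dirichletDensity (one_lt_kernel_param hs hb) (one_lt_kernel_param_last hs hb)

lemma kernel_nonneg (hs : s ∈ simplexInterior d) (hb : 0 < b) {x : Fin d → ℝ}
    (hx : x ∈ simplex d) : 0 ≤ kernel b s x :=
  dirichletDensity_nonneg (one_lt_kernel_param hs hb) (one_lt_kernel_param_last hs hb) hx

lemma integral_kernel (hs : s ∈ simplexInterior d) (hb : 0 < b) :
    ∫ x in simplex d, kernel b s x = 1 :=
  integral_dirichletDensity (one_lt_kernel_param hs hb) (one_lt_kernel_param_last hs hb)

lemma integrableOn_kernel_mul (hs : s ∈ simplexInterior d) (hb : 0 < b) {h : (Fin d → ℝ) → ℝ}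
    (hh : ContinuousOn h (simplex d)) : IntegrableOn (fun x => kernel b s x * h x) (simplex d) :=
  ((continuous_kernel hs hb).continuousOn.mul hh).integrableOn_compact isCompact_simplex

lemma integral_kernel_mul_pow (hs : s ∈ simplexInterior d) (hb : 0 < b) (i : Fin d) (k : ℕ) :
    ∫ x in simplex d, kernel b s x * x i ^ k =
      ∏ j ∈ Finset.range k, ((s i + (1 + j) * b) / (1 + (d + 1 + j) * b)) := by
  unfold kernel
  rw [integral_dirichletDensity_mul_pow (one_lt_kernel_param hs hb)
    (one_lt_kernel_param_last hs hb), sum_kernel_param hs]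
  refine Finset.prod_congr rfl fun j _ => ?_
  field_simp
  ring_nf

lemma integral_kernel_mul_mul (hs : s ∈ simplexInterior d) (hb : 0 < b) (i j : Fin d) :
    ∫ x in simplex d, kernel b s x * (x i * x j) =
      ((s i + b) / (1 + (d + 1) * b)) *
        ((s j + (1 + if i = j then 1 else 0) * b) / (1 + (d + 2) * b)) := by
  have h1 := one_lt_kernel_param hs hb
  have h2 := one_lt_kernel_param_last hs hb
  have h3 : ∀ l, 1 < s l / b + 1 + if l = i then (1 : ℝ) else 0 := fun l => by
    split_ifs <;> linarith [h1 l]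
  have e := integral_dirichletDensity_mul_pow h3 h2 j 1
  simp only [pow_one, Finset.range_one, Finset.prod_singleton, Nat.cast_zero, add_zero] at e
  have e1 : ∑ l, (s l / b + 1 + if l = i then (1 : ℝ) else 0) + ((1 - l1Norm s) / b + 1) =
      1 / b + (d + 2) := by
    rw [Finset.sum_add_distrib, add_right_comm, sum_kernel_param hs]
    simp
    ring
  unfold kernel
  rw [integral_dirichletDensity_mul_apply_mul h1 h2 i fun x => x j, sum_kernel_param hs, e, e1]
  simp_rw [eq_comm (a := j)]
  congr 1
  · field_simp
  · field_simp
    ring_nf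

lemma integral_kernel_mul_sub (hs : s ∈ simplexInterior d) (hb : 0 < b) (i : Fin d) :
    ∫ x in simplex d, kernel b s x * (x i - s i) =
      b * ((1 - (d + 1) * s i) / (1 + (d + 1) * b)) := by
  have h := integral_kernel_mul_pow hs hb i 1
  simp only [pow_one, Finset.range_one, Finset.prod_singleton, Nat.cast_zero, add_zero] at h
  simp_rw [mul_sub]
  rw [integral_sub, h, integral_mul_const, integral_kernel hs hb]
  · field_simp
    ring
  · exact integrableOn_kernel_mul hs hb (by fun_prop)
  · exact integrableOn_kernel_mul hs hb (by fun_prop)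

/-- The leading coefficient `sᵢ(1_{i=j} - sⱼ)` is the one that appears in the second-order part of
`biasTerm`. -/
lemma integral_kernel_mul_sub_mul_sub (hs : s ∈ simplexInterior d) (hb : 0 < b) (i j : Fin d) :
    ∫ x in simplex d, kernel b s x * ((x i - s i) * (x j - s j)) =
      b * ((s i * ((if i = j then 1 else 0) - s j) +
        b * ((1 + if i = j then 1 else 0) - (d + 2) * (s i + s j) +
          s i * s j * (d + 1) * (d + 2))) / ((1 + (d + 1) * b) * (1 + (d + 2) * b))) := by
  have e : ∀ x : Fin d → ℝ, kernel b s x * ((x i - s i) * (x j - s j)) =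
      kernel b s x * (x i * x j) - s j * (kernel b s x * (x i - s i)) -
        s i * (kernel b s x * (x j - s j)) - s i * s j * kernel b s x := by
    intro x; ring
  have i1 := integrableOn_kernel_mul hs hb (h := fun x => x i * x j) (by fun_prop)
  have i2 := (integrableOn_kernel_mul hs hb (h := fun x => x i - s i) (by fun_prop)).const_mul (s j)
  have i3 := (integrableOn_kernel_mul hs hb (h := fun x => x j - s j) (by fun_prop)).const_mul (s i)
  have i4 := ((continuous_kernel hs hb).continuousOn.integrableOn_compact
    (μ := volume) (isCompact_simplex (d := d))).const_mul (s i * s j)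
  simp_rw [e]
  rw [integral_sub, integral_sub, integral_sub i1 i2, integral_const_mul, integral_const_mul, integral_const_mul, integral_kernel hs hb,
    integral_kernel_mul_sub hs hb, integral_kernel_mul_sub hs hb,
    integral_kernel_mul_mul hs hb]
  · generalize (if i = j then (1 : ℝ) else 0) = δ
    field_simp
    ring
  exacts [i1.sub i2, i3, (i1.sub i2).sub i3, i4]

/-- The numerator of the fourth central moment of a coordinate under the Dirichlet kernel, divided by
the square of the bandwidth; here `c = d + 1`. -/
def fourthMomentNum (c s b : ℝ) : ℝ :=
  3 * s ^ 4 - 6 * s ^ 3 + 3 * s ^ 2 +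
    b * ((-6 * c ^ 2 - 22 * c - 18) * s ^ 4 + (6 * c ^ 2 + 42 * c + 64) * s ^ 3 -
      (20 * c + 72) * s ^ 2 + 26 * s) +
    b ^ 2 * ((c ^ 4 + 6 * c ^ 3 + 11 * c ^ 2 + 6 * c) * s ^ 4 -
      (4 * c ^ 3 + 24 * c ^ 2 + 44 * c + 24) * s ^ 3 + (12 * c ^ 2 + 60 * c + 72) * s ^ 2 -
      (24 * c + 72) * s + 24)

/-- The point is the factor `b²`: away from `s`, the Taylor remainder is controlled by fourth powers
and must contribute `o(b)`. -/
lemma integral_kernel_mul_sub_pow_four (hs : s ∈ simplexInterior d) (hb : 0 < b) (i : Fin d) :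
    ∫ x in simplex d, kernel b s x * (x i - s i) ^ 4 =
      b ^ 2 * (fourthMomentNum (d + 1) (s i) b / ((1 + (d + 1) * b) * (1 + (d + 1 + 1) * b) *
        (1 + (d + 1 + 2) * b) * (1 + (d + 1 + 3) * b))) := by
  have e : ∀ x : Fin d → ℝ, kernel b s x * (x i - s i) ^ 4 =
      kernel b s x * x i ^ 4 - 4 * s i * (kernel b s x * x i ^ 3) +
        6 * s i ^ 2 * (kernel b s x * x i ^ 2) - 4 * s i ^ 3 * (kernel b s x * x i ^ 1) +
        s i ^ 4 * (kernel b s x * x i ^ 0) := by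
    intro x; ring
  have h : ∀ k : ℕ, IntegrableOn (fun x => kernel b s x * x i ^ k) (simplex d) := fun k =>
    integrableOn_kernel_mul hs hb (by fun_prop)
  have h3 := (h 3).const_mul (4 * s i)
  have h2 := (h 2).const_mul (6 * s i ^ 2)
  have h1 := (h 1).const_mul (4 * s i ^ 3)
  have h0 := (h 0).const_mul (s i ^ 4)
  simp_rw [e]
  rw [integral_add, integral_sub, integral_add, integral_sub (h 4) h3]
  · simp_rw [integral_const_mul, integral_kernel_mul_pow hs hb]
    simp only [Finset.prod_range_succ, Finset.prod_range_zero, Nat.cast_zero, Nat.cast_one,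
      Nat.cast_ofNat, one_mul, add_zero, fourthMomentNum]
    have p0 : 1 + ((d : ℝ) + 1) * b ≠ 0 := by positivity
    have p1 : 1 + ((d : ℝ) + 1 + 1) * b ≠ 0 := by positivity
    have p2 : 1 + ((d : ℝ) + 1 + 2) * b ≠ 0 := by positivity
    have p3 : 1 + ((d : ℝ) + 1 + 3) * b ≠ 0 := by positivity
    -- The denominators become atoms while fractions are cleared, and are expanded again only for
    -- the final polynomial identity.
    generalize hc : (d : ℝ) + 1 = c at *
    generalize h0 : 1 + c * b = D0 at *
    generalize h1 : 1 + (c + 1) * b = D1 at *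
    generalize h2 : 1 + (c + 2) * b = D2 at *
    generalize h3 : 1 + (c + 3) * b = D3 at *
    field_simp
    rw [← h0, ← h1, ← h2, ← h3]
    ring
  exacts [(h 4).sub h3, h2, ((h 4).sub h3).add h2, h1, (((h 4).sub h3).add h2).sub h1, h0]

end Moments

/-! ### Ratios of Gamma functions -/

/-- The normalised ratio `√z Γ(z + 1/2) / Γ(z + 1)`. -/
noncomputable def gammaRatio (z : ℝ) : ℝ := √z * (Real.Gamma (z + 1 / 2) / Real.Gamma (z + 1))

lemma gammaRatio_pos {z : ℝ} (hz : 0 < z) : 0 < gammaRatio z :=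
  mul_pos (Real.sqrt_pos.2 hz)
    (div_pos (Real.Gamma_pos_of_pos (by linarith)) (Real.Gamma_pos_of_pos (by linarith)))

/-- This is log-convexity of Gamma at a midpoint. Applied to `z, z + 1` and to `z + 1/2, z + 3/2`,
it squeezes `gammaRatio` to 1, which takes the place of Stirling's formula. -/
lemma Gamma_midpoint_sq_le {x y : ℝ} (hx : 0 < x) (hy : 0 < y) :
    Real.Gamma ((x + y) / 2) ^ 2 ≤ Real.Gamma x * Real.Gamma y := by
  have h := Real.Gamma_mul_add_mul_le_rpow_Gamma_mul_rpow_Gamma hx hy (a := 1 / 2) (b := 1 / 2)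
    (by norm_num) (by norm_num) (by norm_num)
  have gx := Real.Gamma_pos_of_pos hx
  have gy := Real.Gamma_pos_of_pos hy
  have e : 1 / 2 * x + 1 / 2 * y = (x + y) / 2 := by ring
  rw [e, ← Real.sqrt_eq_rpow, ← Real.sqrt_eq_rpow, ← Real.sqrt_mul gx.le] at h
  exact (pow_le_pow_left₀ (Real.Gamma_pos_of_pos (by linarith)).le h 2).trans_eq
    (Real.sq_sqrt (by positivity))

lemma gammaRatio_sq_le {z : ℝ} (hz : 0 < z) : gammaRatio z ^ 2 ≤ 1 := by
  have h := Gamma_midpoint_sq_le hz (y := z + 1) (by linarith)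
  have g := Real.Gamma_pos_of_pos (s := z + 1) (by linarith)
  have e : (z + (z + 1)) / 2 = z + 1 / 2 := by ring
  rw [e] at h
  rw [gammaRatio, mul_pow, Real.sq_sqrt hz.le, div_pow, ← mul_div_assoc, div_le_one (by positivity)]
  calc z * Real.Gamma (z + 1 / 2) ^ 2 ≤ z * (Real.Gamma z * Real.Gamma (z + 1)) := by gcongr
    _ = Real.Gamma (z + 1) ^ 2 := by rw [Real.Gamma_add_one hz.ne']; ring

lemma le_gammaRatio_sq {z : ℝ} (hz : 0 < z) : z / (z + 1 / 2) ≤ gammaRatio z ^ 2 := by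
  have h := Gamma_midpoint_sq_le (x := z + 1 / 2) (y := z + 1 / 2 + 1) (by linarith) (by linarith)
  have g := Real.Gamma_pos_of_pos (s := z + 1) (by linarith)
  have e : (z + 1 / 2 + (z + 1 / 2 + 1)) / 2 = z + 1 := by ring
  rw [e, Real.Gamma_add_one (s := z + 1 / 2) (by positivity)] at h
  rw [gammaRatio, mul_pow, Real.sq_sqrt hz.le, div_pow, ← mul_div_assoc,
    div_le_div_iff₀ (by positivity) (by positivity)]
  calc z * Real.Gamma (z + 1) ^ 2
      ≤ z * (Real.Gamma (z + 1 / 2) * ((z + 1 / 2) * Real.Gamma (z + 1 / 2))) := by gcongr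
    _ = _ := by ring

lemma tendsto_gammaRatio : Tendsto gammaRatio atTop (𝓝 1) := by
  have h : Tendsto (fun z => gammaRatio z ^ 2) atTop (𝓝 1) := by
    refine tendsto_of_tendsto_of_tendsto_of_le_of_le' (g := fun z : ℝ => z / (z + 1 / 2))
      ?_ tendsto_const_nhds ?_ ?_
    · have : Tendsto (fun z : ℝ => 1 - (1 / 2) / (z + 1 / 2)) atTop (𝓝 (1 - 0)) :=
        tendsto_const_nhds.sub (tendsto_const_nhds.div_atTop
          (tendsto_atTop_add_const_right _ _ tendsto_id))
      rw [sub_zero] at this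
      refine this.congr' ?_
      filter_upwards [eventually_gt_atTop 0] with z hz
      field_simp
      ring
    · filter_upwards [eventually_gt_atTop 0] with z hz using le_gammaRatio_sq hz
    · filter_upwards [eventually_gt_atTop 0] with z hz using gammaRatio_sq_le hz
  have h2 := (Real.continuous_sqrt.tendsto 1).comp h
  rw [Real.sqrt_one] at h2
  refine h2.congr' ?_
  filter_upwards [eventually_gt_atTop 0] with z hz
  simp [Real.sqrt_sq (gammaRatio_pos hz).le]

/-- Legendre duplication at `z + 1/2`. In `A_b` the Gamma functions occur as such quotients of `Γ(2z
+ 1)` by `Γ(z + 1)²`, so `gammaRatio` is all that needs a limit. -/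
lemma Gamma_two_mul_add_one {z : ℝ} (hz : 0 < z) :
    Real.Gamma (2 * z + 1) =
      Real.Gamma (z + 1) ^ 2 * (4 ^ z * gammaRatio z / (√Real.pi * √z)) := by
  have h := Real.Gamma_mul_Gamma_add_half (z + 1 / 2)
  have e1 : z + 1 / 2 + 1 / 2 = z + 1 := by ring
  have e2 : 2 * (z + 1 / 2) = 2 * z + 1 := by ring
  have e3 : 1 - (2 * z + 1) = -(2 * z) := by ring
  have e4 : (2 : ℝ) ^ (-(2 * z)) = (4 ^ z)⁻¹ := by
    rw [Real.rpow_neg (by norm_num), Real.rpow_mul (by norm_num)]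
    norm_num
  rw [e1, e2, e3, e4] at h
  have g := Real.Gamma_pos_of_pos (s := z + 1) (by linarith)
  have p4 : (0 : ℝ) < 4 ^ z := by positivity
  have pp : 0 < √Real.pi := Real.sqrt_pos.2 Real.pi_pos
  have pz : 0 < √z := Real.sqrt_pos.2 hz
  rw [gammaRatio]
  generalize Real.Gamma (z + 1) = G1 at *
  generalize Real.Gamma (2 * z + 1) = G2 at *
  generalize Real.Gamma (z + 1 / 2) = G3 at *
  field_simp
  field_simp at h
  linarith

lemma Gamma_add_one_add_nat {z : ℝ} (hz : 0 < z) (n : ℕ) :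
    Real.Gamma (z + (n + 1)) = Real.Gamma (z + 1) * ∏ k ∈ Finset.range n, (z + (1 + k)) := by
  induction n with
  | zero => simp
  | succ n ih =>
    have e : z + (((n + 1 : ℕ) : ℝ) + 1) = z + (n + 1) + 1 := by push_cast; ring
    rw [e, Real.Gamma_add_one (by positivity), ih, Finset.prod_range_succ]
    ring

/-! ### The square of the Dirichlet kernel -/

/-- The normalising constant of the Dirichlet kernel. -/
noncomputable def normConst (b : ℝ) (s : Fin d → ℝ) : ℝ :=
  Real.Gamma (1 / b + (d + 1)) /
    (Real.Gamma ((1 - l1Norm s) / b + 1) * ∏ i, Real.Gamma (s i / b + 1))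

/-- The factor `A_b(s)` for which `K_b² = A_b K_{b/2}`. -/
noncomputable def sqConst (b : ℝ) (s : Fin d → ℝ) : ℝ := normConst b s ^ 2 / normConst (b / 2) s

section

variable {s : Fin d → ℝ} {b : ℝ}

lemma normConst_pos (hs : s ∈ simplexInterior d) (hb : 0 < b) : 0 < normConst b s :=
  div_pos (Real.Gamma_pos_of_pos (by positivity)) (mul_pos
    (Real.Gamma_pos_of_pos (by linarith [one_lt_kernel_param_last hs hb]))
    (Finset.prod_pos fun i _ => Real.Gamma_pos_of_pos (by linarith [one_lt_kernel_param hs hb i])))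

lemma kernel_eq (hs : s ∈ simplexInterior d) (hb : 0 < b) (x : Fin d → ℝ) :
    kernel b s x =
      normConst b s * ((1 - l1Norm x) ^ ((1 - l1Norm s) / b) * ∏ i, x i ^ (s i / b)) := by
  rw [kernel, dirichletDensity, l1Norm_of_nonneg fun i => by
    linarith [one_lt_kernel_param hs hb i], sum_kernel_param hs, normConst]
  simp

/-- Squaring doubles every exponent `u/b`, which is the same as halving the bandwidth; only the
normalising constant changes. -/
lemma kernel_sq (hs : s ∈ simplexInterior d) (hb : 0 < b) {x : Fin d → ℝ} (hx : x ∈ simplex d) :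
    kernel b s x ^ 2 = sqConst b s * kernel (b / 2) s x := by
  have hc := (normConst_pos hs (half_pos hb)).ne'
  have e : ∀ a y : ℝ, 0 ≤ y → (y ^ (a / b)) ^ 2 = y ^ (a / (b / 2)) := by
    intro a y hy
    rw [← Real.rpow_mul_natCast hy]
    congr 1
    push_cast
    field_simp
  rw [kernel_eq hs hb, kernel_eq hs (half_pos hb), sqConst, mul_pow, mul_pow,
    e _ _ (by linarith [hx.2]), ← Finset.prod_pow]
  simp_rw [fun i => e (s i) (x i) (hx.1 i).1]
  field_simp

/-- Duplication is applied to the `d + 1` barycentric coordinates and to their total 1. The powers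
of 4 cancel since the coordinates sum to 1, one factor `√b/√π` cancels against the total, and the
integer shift `d` in the total produces the product over `k`. -/
lemma sqrt_pow_mul_sqConst (hs : s ∈ simplexInterior d) (hb : 0 < b) :
    √b ^ d * sqConst b s = (√Real.pi ^ d)⁻¹ *
      (∏ k ∈ Finset.range d, (1 + (1 + k) * b) ^ 2 / (2 + (1 + k) * b)) *
      ((√(1 - l1Norm s))⁻¹ * gammaRatio ((1 - l1Norm s) / b) *
        ∏ i, ((√(s i))⁻¹ * gammaRatio (s i / b))) / gammaRatio (1 / b) := by
  have u0 : 0 < 1 - l1Norm s := sub_pos.2 hs.2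
  have si : ∀ i, 0 < s i := fun i => (hs.1 i).1
  have sb : 0 < √b := Real.sqrt_pos.2 hb
  have pp : 0 < √Real.pi := Real.sqrt_pos.2 Real.pi_pos
  have dbl : ∀ u : ℝ, 0 < u → Real.Gamma (u / (b / 2) + 1) = Real.Gamma (u / b + 1) ^ 2 *
      (4 ^ (u / b) * ((√u)⁻¹ * gammaRatio (u / b)) * (√b / √Real.pi)) := by
    intro u hu
    have hu' := Real.sqrt_pos.2 hu
    have e : u / (b / 2) + 1 = 2 * (u / b) + 1 := by field_simp
    rw [e, Gamma_two_mul_add_one (div_pos hu hb), Real.sqrt_div hu.le]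
    field_simp
  have four : (4 : ℝ) ^ (1 / b) = 4 ^ ((1 - l1Norm s) / b) * ∏ i, (4 : ℝ) ^ (s i / b) := by
    rw [← Real.rpow_sum_of_pos (by norm_num), ← Real.rpow_add (by norm_num), ← Finset.sum_div,
      l1Norm_of_nonneg fun i => (si i).le]
    congr 1
    ring
  have top : Real.Gamma (1 / (b / 2) + (d + 1)) = Real.Gamma (1 / b + 1) ^ 2 *
      (4 ^ (1 / b) * ((√1)⁻¹ * gammaRatio (1 / b)) * (√b / √Real.pi)) *
        ∏ k ∈ Finset.range d, (b⁻¹ * (2 + (1 + k) * b)) := by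
    rw [Gamma_add_one_add_nat (by positivity), dbl 1 one_pos]
    congr 1
    refine Finset.prod_congr rfl fun k _ => ?_
    field_simp
  have top' : Real.Gamma (1 / b + (d + 1)) = Real.Gamma (1 / b + 1) *
      ∏ k ∈ Finset.range d, (b⁻¹ * (1 + (1 + k) * b)) := by
    rw [Gamma_add_one_add_nat (by positivity)]
    congr 1
    refine Finset.prod_congr rfl fun k _ => ?_
    field_simp
  have g0 := Real.Gamma_pos_of_pos (s := 1 / b + 1) (by positivity)
  have g1 := Real.Gamma_pos_of_pos (s := (1 - l1Norm s) / b + 1) (by positivity)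
  have g2 : 0 < ∏ i, Real.Gamma (s i / b + 1) := Finset.prod_pos fun i _ =>
    Real.Gamma_pos_of_pos (by linarith [one_lt_kernel_param hs hb i])
  have r0 := gammaRatio_pos (z := 1 / b) (by positivity)
  have r1 := gammaRatio_pos (z := (1 - l1Norm s) / b) (by positivity)
  have r2 : 0 < ∏ i, gammaRatio (s i / b) := Finset.prod_pos fun i _ =>
    gammaRatio_pos (div_pos (si i) hb)
  have q1 : 0 < √(1 - l1Norm s) := Real.sqrt_pos.2 u0
  have q2 : 0 < ∏ i, √(s i) := Finset.prod_pos fun i _ => Real.sqrt_pos.2 (si i)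
  have f1 : (0 : ℝ) < 4 ^ ((1 - l1Norm s) / b) := by positivity
  have f2 : 0 < ∏ i, (4 : ℝ) ^ (s i / b) := Finset.prod_pos fun i _ => by positivity
  have t1 : 0 < ∏ k ∈ Finset.range d, (1 + (1 + (k : ℝ)) * b) :=
    Finset.prod_pos fun k _ => by positivity
  have t2 : 0 < ∏ k ∈ Finset.range d, (2 + (1 + (k : ℝ)) * b) :=
    Finset.prod_pos fun k _ => by positivity
  rw [sqConst, normConst, normConst, dbl _ u0, top, top', four]
  simp_rw [fun i => dbl (s i) (si i)]
  simp only [Finset.prod_mul_distrib, Finset.prod_div_distrib, Finset.prod_pow, Finset.prod_const,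
    Finset.card_univ, Fintype.card_fin, Finset.card_range, Finset.prod_inv_distrib, Real.sqrt_one]
  have bb : b ^ d = √b ^ d * √b ^ d := by rw [← mul_pow, Real.mul_self_sqrt hb.le]
  generalize Real.Gamma (1 / b + 1) = G0 at *
  generalize Real.Gamma ((1 - l1Norm s) / b + 1) = G1 at *
  generalize ∏ i, Real.Gamma (s i / b + 1) = G2 at *
  generalize gammaRatio (1 / b) = R0 at *
  generalize gammaRatio ((1 - l1Norm s) / b) = R1 at *
  generalize ∏ i, gammaRatio (s i / b) = R2 at *
  generalize √(1 - l1Norm s) = Q1 at *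
  generalize ∏ i, √(s i) = Q2 at *
  generalize (4 : ℝ) ^ ((1 - l1Norm s) / b) = F1 at *
  generalize ∏ i, (4 : ℝ) ^ (s i / b) = F2 at *
  generalize ∏ k ∈ Finset.range d, (1 + (1 + (k : ℝ)) * b) = T1 at *
  generalize ∏ k ∈ Finset.range d, (2 + (1 + (k : ℝ)) * b) = T2 at *
  rw [inv_pow, bb, div_pow]
  have w1 : 0 < √b ^ d := pow_pos sb d
  have w2 : 0 < √Real.pi ^ d := pow_pos pp d
  generalize √b ^ d = W1 at *
  generalize √Real.pi ^ d = W2 at *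
  field_simp

lemma psi_eq (hs : s ∈ simplexInterior d) :
    psi s = (√Real.pi ^ d)⁻¹ * (2 ^ d)⁻¹ * ((√(1 - l1Norm s))⁻¹ * ∏ i, (√(s i))⁻¹) := by
  have u0 : 0 < 1 - l1Norm s := sub_pos.2 hs.2
  have si : ∀ i, 0 < s i := fun i => (hs.1 i).1
  have pr : 0 < ∏ i, s i := Finset.prod_pos fun i _ => si i
  have e : √(4 * Real.pi) = 2 * √Real.pi := by
    rw [Real.sqrt_mul (by norm_num), show (4 : ℝ) = 2 ^ 2 by norm_num, Real.sqrt_sq (by norm_num)]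
  have e2 : √((4 * Real.pi) ^ d) = (2 * √Real.pi) ^ d := by
    rw [← e]
    refine (Real.sqrt_eq_iff_mul_self_eq (by positivity) (by positivity)).2 ?_
    rw [← mul_pow, Real.mul_self_sqrt (by positivity)]
  have e3 : √(∏ i, s i) = ∏ i, √(s i) := by
    refine (Real.sqrt_eq_iff_mul_self_eq pr.le (Finset.prod_nonneg fun _ _ => Real.sqrt_nonneg _)).2 ?_
    rw [← Finset.prod_mul_distrib]
    exact Finset.prod_congr rfl fun i _ => (Real.mul_self_sqrt (si i).le).symm
  rw [psi, Real.rpow_neg (by positivity), ← Real.sqrt_eq_rpow, Real.sqrt_mul (by positivity),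
    Real.sqrt_mul (by positivity), e2, e3, mul_pow, Finset.prod_inv_distrib]
  simp only [mul_inv]
  ring

lemma tendsto_const_div_nhdsGT_zero {u : ℝ} (hu : 0 < u) :
    Tendsto (fun b : ℝ => u / b) (𝓝[>] 0) atTop := by
  simpa only [div_eq_mul_inv] using tendsto_inv_nhdsGT_zero.const_mul_atTop hu

theorem tendsto_sqrt_pow_mul_sqConst (hs : s ∈ simplexInterior d) :
    Tendsto (fun b => √b ^ d * sqConst b s) (𝓝[>] 0) (𝓝 (psi s)) := by
  have r : ∀ u : ℝ, 0 < u → Tendsto (fun b : ℝ => gammaRatio (u / b)) (𝓝[>] 0) (𝓝 1) :=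
    fun u hu => tendsto_gammaRatio.comp (tendsto_const_div_nhdsGT_zero hu)
  -- The factors `1/2` give the `2^(-d)` that completes `π^(-d/2)` to `(4π)^(-d/2)`.
  have t : Tendsto (fun b : ℝ => ∏ k ∈ Finset.range d, (1 + (1 + (k : ℝ)) * b) ^ 2 /
      (2 + (1 + k) * b)) (𝓝[>] 0) (𝓝 (∏ k ∈ Finset.range d, (1 / 2 : ℝ))) := by
    refine tendsto_finsetProd _ fun k _ => tendsto_nhdsWithin_of_tendsto_nhds ?_
    have : ContinuousAt (fun b : ℝ => (1 + (1 + (k : ℝ)) * b) ^ 2 / (2 + (1 + k) * b)) 0 := by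
      refine ContinuousAt.div (by fun_prop) (by fun_prop) (by simp)
    simpa [ContinuousAt] using this
  have lim := (((tendsto_const_nhds (x := (√Real.pi ^ d)⁻¹)).mul t).mul
    (((r _ (sub_pos.2 hs.2)).const_mul ((√(1 - l1Norm s))⁻¹)).mul
      (tendsto_finsetProd Finset.univ fun i _ => (r _ (hs.1 i).1).const_mul ((√(s i))⁻¹)))).div
      (r 1 one_pos) one_ne_zero
  rw [psi_eq hs]
  simp only [Finset.prod_const, Finset.card_range, mul_one, div_one, one_div, inv_pow] at lim
  refine lim.congr' ?_
  filter_upwards [self_mem_nhdsWithin] with b hb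
  rw [sqrt_pow_mul_sqConst hs hb]
  simp

end

variable {s : Fin d → ℝ}

/-! ### Approximation by the Dirichlet kernel -/

lemma integrableOn_kernel (hs : s ∈ simplexInterior d) {b : ℝ} (hb : 0 < b) :
    IntegrableOn (kernel b s) (simplex d) :=
  (continuous_kernel hs hb).continuousOn.integrableOn_compact isCompact_simplex

lemma abs_integral_kernel_mul_le (hs : s ∈ simplexInterior d) {b : ℝ} (hb : 0 < b)
    {h g : (Fin d → ℝ) → ℝ} (hg : ContinuousOn g (simplex d))
    (hle : ∀ x ∈ simplex d, |h x| ≤ g x) :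
    |∫ x in simplex d, kernel b s x * h x| ≤ ∫ x in simplex d, kernel b s x * g x := by
  rw [← Real.norm_eq_abs]
  refine norm_integral_le_of_norm_le (integrableOn_kernel_mul hs hb hg)
    ((ae_restrict_iff' measurableSet_simplex).2 (ae_of_all _ fun x hx => ?_))
  rw [Real.norm_eq_abs, abs_mul, abs_of_nonneg (kernel_nonneg hs hb hx)]
  exact mul_le_mul_of_nonneg_left (hle x hx) (kernel_nonneg hs hb hx)

lemma integral_kernel_mul_sub_const (hs : s ∈ simplexInterior d) {b : ℝ} (hb : 0 < b)
    {f : (Fin d → ℝ) → ℝ} (hf : ContinuousOn f (simplex d)) (c : ℝ) :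
    ∫ x in simplex d, kernel b s x * (f x - c) = (∫ x in simplex d, kernel b s x * f x) - c := by
  simp_rw [mul_sub]
  rw [integral_sub (integrableOn_kernel_mul hs hb hf) ((integrableOn_kernel hs hb).mul_const c),
    integral_mul_const, integral_kernel hs hb, one_mul]

lemma integral_kernel_mul_sum {ι : Type*} (t : Finset ι) (hs : s ∈ simplexInterior d) {b : ℝ}
    (hb : 0 < b) {h : ι → (Fin d → ℝ) → ℝ} (hh : ∀ i, ContinuousOn (h i) (simplex d)) :
    ∫ x in simplex d, kernel b s x * ∑ i ∈ t, h i x =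
      ∑ i ∈ t, ∫ x in simplex d, kernel b s x * h i x := by
  simp_rw [Finset.mul_sum]
  exact integral_finsetSum _ fun i _ => integrableOn_kernel_mul hs hb (hh i)

lemma tendsto_inv_mul_integral_kernel_mul_sub (hs : s ∈ simplexInterior d) (i : Fin d) :
    Tendsto (fun b => b⁻¹ * ∫ x in simplex d, kernel b s x * (x i - s i)) (𝓝[>] 0)
      (𝓝 (1 - (d + 1) * s i)) := by
  have lim : Tendsto (fun b : ℝ => (1 - (d + 1) * s i) / (1 + (d + 1) * b)) (𝓝[>] 0)
      (𝓝 (1 - (d + 1) * s i)) := by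
    refine tendsto_nhdsWithin_of_tendsto_nhds ?_
    have : ContinuousAt (fun b : ℝ => (1 - (d + 1) * s i) / (1 + (d + 1) * b)) 0 :=
      ContinuousAt.div (by fun_prop) (by fun_prop) (by simp)
    simpa [ContinuousAt] using this
  refine lim.congr' ?_
  filter_upwards [self_mem_nhdsWithin] with b hb
  rw [integral_kernel_mul_sub hs hb, inv_mul_cancel_left₀ (ne_of_gt hb)]

lemma tendsto_inv_mul_integral_kernel_mul_sub_mul_sub (hs : s ∈ simplexInterior d) (i j : Fin d) :
    Tendsto (fun b => b⁻¹ * ∫ x in simplex d, kernel b s x * ((x i - s i) * (x j - s j)))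
      (𝓝[>] 0) (𝓝 (s i * ((if i = j then 1 else 0) - s j))) := by
  have lim : Tendsto (fun b : ℝ => (s i * ((if i = j then 1 else 0) - s j) +
        b * ((1 + if i = j then 1 else 0) - (d + 2) * (s i + s j) +
          s i * s j * (d + 1) * (d + 2))) / ((1 + (d + 1) * b) * (1 + (d + 2) * b))) (𝓝[>] 0)
      (𝓝 (s i * ((if i = j then 1 else 0) - s j))) := by
    refine tendsto_nhdsWithin_of_tendsto_nhds ?_
    have : ContinuousAt (fun b : ℝ => (s i * ((if i = j then 1 else 0) - s j) +
        b * ((1 + if i = j then 1 else 0) - (d + 2) * (s i + s j) +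
          s i * s j * (d + 1) * (d + 2))) / ((1 + (d + 1) * b) * (1 + (d + 2) * b))) 0 :=
      ContinuousAt.div (by fun_prop) (by fun_prop) (by simp)
    simpa [ContinuousAt] using this
  refine lim.congr' ?_
  filter_upwards [self_mem_nhdsWithin] with b hb
  rw [integral_kernel_mul_sub_mul_sub hs hb, inv_mul_cancel_left₀ (ne_of_gt hb)]

lemma tendsto_inv_mul_integral_kernel_mul_sub_pow_four (hs : s ∈ simplexInterior d) (i : Fin d) :
    Tendsto (fun b => b⁻¹ * ∫ x in simplex d, kernel b s x * (x i - s i) ^ 4) (𝓝[>] 0)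
      (𝓝 0) := by
  have lim : Tendsto (fun b : ℝ => b * (fourthMomentNum (d + 1) (s i) b / ((1 + (d + 1) * b) *
      (1 + (d + 1 + 1) * b) * (1 + (d + 1 + 2) * b) * (1 + (d + 1 + 3) * b)))) (𝓝[>] 0)
      (𝓝 0) := by
    refine tendsto_nhdsWithin_of_tendsto_nhds ?_
    have : ContinuousAt (fun b : ℝ => b * (fourthMomentNum (d + 1) (s i) b / ((1 + (d + 1) * b) *
      (1 + (d + 1 + 1) * b) * (1 + (d + 1 + 2) * b) * (1 + (d + 1 + 3) * b)))) 0 := by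
      unfold fourthMomentNum
      exact continuousAt_id.mul (ContinuousAt.div (by fun_prop) (by fun_prop) (by simp))
    simpa [ContinuousAt] using this
  refine lim.congr' ?_
  filter_upwards [self_mem_nhdsWithin] with b hb
  have : b ≠ 0 := ne_of_gt hb
  rw [integral_kernel_mul_sub_pow_four hs hb]
  field_simp

lemma tendsto_inv_mul_integral_kernel_mul_sum_sq (hs : s ∈ simplexInterior d) :
    Tendsto (fun b => b⁻¹ * ∫ x in simplex d, kernel b s x * ∑ i, (x i - s i) ^ 2) (𝓝[>] 0)
      (𝓝 (∑ i, s i * (1 - s i))) := by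
  have h := tendsto_finsetSum Finset.univ fun i _ =>
    tendsto_inv_mul_integral_kernel_mul_sub_mul_sub hs i i
  simp only [if_true] at h
  refine h.congr' ?_
  filter_upwards [self_mem_nhdsWithin] with b hb
  rw [integral_kernel_mul_sum _ hs hb fun i => by fun_prop, Finset.mul_sum]
  simp_rw [sq]

lemma tendsto_inv_mul_integral_kernel_mul_sum_pow_four (hs : s ∈ simplexInterior d) :
    Tendsto (fun b => b⁻¹ * ∫ x in simplex d, kernel b s x * ∑ i, (x i - s i) ^ 4) (𝓝[>] 0)
      (𝓝 0) := by
  have h := tendsto_finsetSum Finset.univ fun i _ =>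
    tendsto_inv_mul_integral_kernel_mul_sub_pow_four hs i
  simp only [Finset.sum_const_zero] at h
  refine h.congr' ?_
  filter_upwards [self_mem_nhdsWithin] with b hb
  rw [integral_kernel_mul_sum _ hs hb fun i => by fun_prop, Finset.mul_sum]

lemma norm_sub_pow_le_sum {k : ℕ} (hk : Even k) (hk0 : k ≠ 0) (x s : Fin d → ℝ) :
    ‖x - s‖ ^ k ≤ ∑ i, (x i - s i) ^ k := by
  have nn : ∀ i, 0 ≤ (x i - s i) ^ k := fun i => hk.pow_nonneg _
  rcases isEmpty_or_nonempty (Fin d) with h | h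
  · simp [Subsingleton.elim x s, hk0]
  · obtain ⟨i, hi⟩ : ∃ i, ‖x - s‖ = ‖(x - s) i‖ := by
      obtain ⟨i, -, hi⟩ := Finset.exists_max_image Finset.univ (fun i => ‖(x - s) i‖)
        Finset.univ_nonempty
      exact ⟨i, le_antisymm ((pi_norm_le_iff_of_nonneg (norm_nonneg _)).2 fun j =>
        hi j (Finset.mem_univ j)) (norm_le_pi_norm _ i)⟩
    rw [hi, Real.norm_eq_abs, hk.pow_abs]
    exact Finset.single_le_sum (f := fun i => (x i - s i) ^ k) (fun j _ => nn j)
      (Finset.mem_univ i)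

/-- A local bound becomes global: at distance at least `δ` from `s` the sum is at least `δ^k`, so a
bound for `h` on the compact simplex divided by `δ^k` serves as `C`. -/
lemma exists_abs_le_add_sum_pow {h g : (Fin d → ℝ) → ℝ} (hh : ContinuousOn h (simplex d))
    (hg : ∀ x, 0 ≤ g x) (hle : ∀ᶠ x in 𝓝 s, |h x| ≤ g x) {k : ℕ} (hk : Even k) (hk0 : k ≠ 0) :
    ∃ C, 0 ≤ C ∧ ∀ x ∈ simplex d, |h x| ≤ g x + C * ∑ i, (x i - s i) ^ k := by
  obtain ⟨δ, δ0, hδ⟩ := Metric.eventually_nhds_iff.1 hle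
  obtain ⟨B, hB⟩ := isCompact_simplex.exists_bound_of_continuousOn hh
  refine ⟨max B 0 / δ ^ k, by positivity, fun x hx => ?_⟩
  have nn : 0 ≤ ∑ i, (x i - s i) ^ k := Finset.sum_nonneg fun i _ => hk.pow_nonneg _
  rcases lt_or_ge (dist x s) δ with hd | hd
  · exact (hδ hd).trans (le_add_of_nonneg_right (by positivity))
  · have h1 : δ ^ k ≤ ∑ i, (x i - s i) ^ k := by
      refine le_trans ?_ (norm_sub_pow_le_sum hk hk0 x s)
      rw [← dist_eq_norm]
      gcongr
    have h2 : max B 0 ≤ max B 0 / δ ^ k * ∑ i, (x i - s i) ^ k := by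
      rw [div_mul_eq_mul_div, le_div_iff₀ (by positivity)]
      gcongr
    calc |h x| ≤ B := hB x hx
      _ ≤ max B 0 := le_max_left _ _
      _ ≤ _ := by linarith [hg x]

/-- If the weighted integrals of `p` stay bounded, those of `q` vanish, and `h` is bounded by
`ε p + C_ε q` for every `ε`, then the weighted integrals of `h` vanish. -/
lemma tendsto_weight_mul_integral_kernel_mul (hs : s ∈ simplexInterior d) {w : ℝ → ℝ}
    (hw : ∀ b, 0 < b → 0 ≤ w b) {h p q : (Fin d → ℝ) → ℝ}
    (hp : ContinuousOn p (simplex d)) (hq : ContinuousOn q (simplex d)) {B : ℝ}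
    (hB : Tendsto (fun b => w b * ∫ x in simplex d, kernel b s x * p x) (𝓝[>] 0) (𝓝 B))
    (h0 : Tendsto (fun b => w b * ∫ x in simplex d, kernel b s x * q x) (𝓝[>] 0) (𝓝 0))
    (hle : ∀ ε > 0, ∃ C, 0 ≤ C ∧ ∀ x ∈ simplex d, |h x| ≤ ε * p x + C * q x) :
    Tendsto (fun b => w b * ∫ x in simplex d, kernel b s x * h x) (𝓝[>] 0) (𝓝 0) := by
  rw [Metric.tendsto_nhds]
  intro ε ε0
  -- This choice gives `η B ≤ ε/2` whatever the sign of `B`, including `B = 0`.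
  set η := ε / (2 * (|B| + 1)) with hη
  have η0 : 0 < η := by positivity
  obtain ⟨C, C0, hC⟩ := hle η η0
  have lim := (hB.const_mul η).add (h0.const_mul C)
  have lt : η * B + C * 0 < ε := by
    have : η * B ≤ η * (|B| + 1) := by gcongr; linarith [le_abs_self B]
    have e : η * (|B| + 1) = ε / 2 := by rw [hη]; field_simp
    linarith
  filter_upwards [lim.eventually_lt_const lt, self_mem_nhdsWithin] with b hb hb0
  have hb0' : 0 < b := hb0
  rw [Real.dist_eq, sub_zero, abs_mul, abs_of_nonneg (hw b hb0')]
  refine lt_of_le_of_lt ?_ hb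
  have := abs_integral_kernel_mul_le hs hb0' (h := h) (g := fun x => η * p x + C * q x)
    (by fun_prop) hC
  have e : ∫ x in simplex d, kernel b s x * (η * p x + C * q x) =
      η * (∫ x in simplex d, kernel b s x * p x) + C * ∫ x in simplex d, kernel b s x * q x := by
    rw [← integral_const_mul, ← integral_const_mul, ← integral_add
      ((integrableOn_kernel_mul hs hb0' hp).const_mul η)
      ((integrableOn_kernel_mul hs hb0' hq).const_mul C)]
    congr 1 with x
    ring
  calc _ ≤ w b * ∫ x in simplex d, kernel b s x * (η * p x + C * q x) :=
        mul_le_mul_of_nonneg_left this (hw b hb0')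
    _ = _ := by rw [e]; ring

theorem tendsto_integral_kernel_mul (hs : s ∈ simplexInterior d) {f : (Fin d → ℝ) → ℝ}
    (hf : ContinuousOn f (simplex d)) :
    Tendsto (fun b => ∫ x in simplex d, kernel b s x * f x) (𝓝[>] 0) (𝓝 (f s)) := by
  have nhds : simplex d ∈ 𝓝 s :=
    mem_of_superset (isOpen_simplexInterior.mem_nhds hs) simplexInterior_subset
  have id0 : Tendsto (fun b : ℝ => b) (𝓝[>] 0) (𝓝 0) := tendsto_nhdsWithin_of_tendsto_nhds tendsto_id
  have key := tendsto_weight_mul_integral_kernel_mul hs (w := fun _ => 1) (fun _ _ => zero_le_one)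
    (h := fun x => f x - f s) (p := fun _ => 1) (q := fun x => ∑ i, (x i - s i) ^ 2) (B := 1)
    (by fun_prop) (by fun_prop) ?_ ?_ ?_
  · have := key.add_const (f s)
    rw [zero_add] at this
    refine this.congr' ?_
    filter_upwards [self_mem_nhdsWithin] with b hb
    rw [integral_kernel_mul_sub_const hs hb hf]
    ring
  · refine tendsto_const_nhds.congr' ?_
    filter_upwards [self_mem_nhdsWithin] with b hb
    simp [integral_kernel hs hb]
  · have := id0.mul (tendsto_inv_mul_integral_kernel_mul_sum_sq hs)
    rw [zero_mul] at this
    refine this.congr' ?_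
    filter_upwards [self_mem_nhdsWithin] with b hb
    rw [one_mul, mul_inv_cancel_left₀ (ne_of_gt hb)]
  · intro ε ε0
    have hc : Tendsto f (𝓝 s) (𝓝 (f s)) := (hf.continuousAt nhds)
    obtain ⟨C, C0, hC⟩ := exists_abs_le_add_sum_pow (s := s) (h := fun x => f x - f s)
      (g := fun _ => ε) (by fun_prop) (fun _ => ε0.le)
      ((Metric.tendsto_nhds.1 hc ε ε0).mono fun x hx => hx.le) even_two two_ne_zero
    exact ⟨C, C0, fun x hx => by simpa using hC x hx⟩

/-- The kernel has spread of order `√b`: its second central moment, summed over coordinates, is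
eventually below `(V + 1) b`, and `‖x - s‖ ≤ √b (1 + ‖x - s‖²/b)` reduces the Lipschitz bound to
that moment. -/
theorem exists_abs_integral_kernel_mul_sub_le (hs : s ∈ simplexInterior d) {f : (Fin d → ℝ) → ℝ}
    {L : NNReal} (hf : LipschitzOnWith L f (simplex d)) :
    ∃ C, ∀ᶠ b in 𝓝[>] 0, |(∫ x in simplex d, kernel b s x * f x) - f s| ≤ C * √b := by
  set V := ∑ i, s i * (1 - s i)
  refine ⟨L * (1 + (V + 1)), ?_⟩
  filter_upwards [(tendsto_inv_mul_integral_kernel_mul_sum_sq hs).eventually_lt_const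
    (lt_add_one V), self_mem_nhdsWithin] with b hV hb
  have hb' : 0 < b := hb
  have sb : 0 < √b := Real.sqrt_pos.2 hb'
  rw [← integral_kernel_mul_sub_const hs hb hf.continuousOn]
  have h1 : ∀ x ∈ simplex d, |f x - f s| ≤
      L * √b * (1 + b⁻¹ * ∑ i, (x i - s i) ^ 2) := by
    intro x hx
    have hl := hf.dist_le_mul x hx s (simplexInterior_subset hs)
    rw [Real.dist_eq, dist_eq_norm] at hl
    have hn := norm_sub_pow_le_sum even_two two_ne_zero x s
    have h2 : ‖x - s‖ ≤ √b * (1 + b⁻¹ * ‖x - s‖ ^ 2) := by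
      have e : √b * (1 + b⁻¹ * ‖x - s‖ ^ 2) = √b + ‖x - s‖ ^ 2 / √b := by
        nth_rewrite 2 [← Real.mul_self_sqrt hb'.le]
        field_simp
      have e2 : √b + ‖x - s‖ ^ 2 / √b - ‖x - s‖ =
          ((‖x - s‖ - √b / 2) ^ 2 + 3 / 4 * √b ^ 2) / √b := by
        field_simp
        ring
      have : 0 ≤ √b + ‖x - s‖ ^ 2 / √b - ‖x - s‖ := by rw [e2]; positivity
      linarith
    calc |f x - f s| ≤ L * ‖x - s‖ := hl
      _ ≤ L * (√b * (1 + b⁻¹ * ‖x - s‖ ^ 2)) := by gcongr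
      _ ≤ L * (√b * (1 + b⁻¹ * ∑ i, (x i - s i) ^ 2)) := by gcongr
      _ = _ := by ring
  refine (abs_integral_kernel_mul_le hs hb' (by fun_prop) h1).trans ?_
  have e : ∫ x in simplex d, kernel b s x * (L * √b * (1 + b⁻¹ * ∑ i, (x i - s i) ^ 2)) =
      L * √b * (1 + b⁻¹ * ∫ x in simplex d, kernel b s x * ∑ i, (x i - s i) ^ 2) := by
    have i2 := integrableOn_kernel_mul hs hb' (h := fun x => ∑ i, (x i - s i) ^ 2) (by fun_prop)
    have e1 : ∀ x, kernel b s x * (L * √b * (1 + b⁻¹ * ∑ i, (x i - s i) ^ 2)) =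
        L * √b * (kernel b s x + b⁻¹ * (kernel b s x * ∑ i, (x i - s i) ^ 2)) := fun x => by ring
    simp_rw [e1]
    rw [integral_const_mul, integral_add (integrableOn_kernel hs hb') (i2.const_mul _),
      integral_const_mul, integral_kernel hs hb']
  rw [e]
  calc L * √b * (1 + b⁻¹ * ∫ x in simplex d, kernel b s x * ∑ i, (x i - s i) ^ 2)
      ≤ L * √b * (1 + (V + 1)) := by gcongr
    _ = _ := by ring

/-! ### Second order expansion -/

lemma simplex_mem_nhds (hs : s ∈ simplexInterior d) : simplex d ∈ 𝓝 s :=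
  mem_of_superset (isOpen_simplexInterior.mem_nhds hs) simplexInterior_subset

/-- Taylor's theorem of order two with Peano remainder. -/
theorem eventually_abs_sub_taylor_two_le {E : Type*} [NormedAddCommGroup E] [NormedSpace ℝ E]
    {f : E → ℝ} {s : E} (hf : ContDiffAt ℝ 2 f s) {ε : ℝ} (ε0 : 0 < ε) :
    ∀ᶠ x in 𝓝 s, |f x - f s - fderiv ℝ f s (x - s) -
      1 / 2 * fderiv ℝ (fderiv ℝ f) s (x - s) (x - s)| ≤ ε * ‖x - s‖ ^ 2 := by
  set H := fderiv ℝ (fderiv ℝ f) s with hH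
  have symm : IsSymmSndFDerivAt ℝ f s := hf.isSymmSndFDerivAt (by simp)
  have d1 : ∀ᶠ x in 𝓝 s, DifferentiableAt ℝ f x :=
    (hf.eventually (by simp)).mono fun x hx => hx.differentiableAt two_ne_zero
  have d2 : HasFDerivAt (fderiv ℝ f) H s :=
    ((hf.fderiv_right (m := 1) (by norm_num)).differentiableAt one_ne_zero).hasFDerivAt
  have lo := (hasFDerivAt_iff_isLittleO.1 d2).def ε0
  obtain ⟨δ, δ0, hδ⟩ := Metric.eventually_nhds_iff_ball.1 (d1.and lo)
  filter_upwards [Metric.ball_mem_nhds s δ0] with y hy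
  -- The derivative of `R` at `x` is the first-order remainder of `fderiv ℝ f`, at most `ε‖x - s‖`
  -- near `s`. The mean value inequality on the ball of radius `‖y - s‖` supplies the second factor.
  set R : E → ℝ := fun x => f x - fderiv ℝ f s (x - s) - 1 / 2 * H (x - s) (x - s) with hR
  have sub : Metric.closedBall s ‖y - s‖ ⊆ Metric.ball s δ := fun x hx => by
    rw [Metric.mem_closedBall] at hx
    rw [Metric.mem_ball, dist_eq_norm] at hy
    exact lt_of_le_of_lt hx hy
  have dR : ∀ x ∈ Metric.closedBall s ‖y - s‖, HasFDerivWithinAt R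
      (fderiv ℝ f x - fderiv ℝ f s - H (x - s)) (Metric.closedBall s ‖y - s‖) x := by
    intro x hx
    refine HasFDerivAt.hasFDerivWithinAt ?_
    have hsub : HasFDerivAt (fun x => x - s) (ContinuousLinearMap.id ℝ E) x :=
      (hasFDerivAt_id x).sub_const s
    have h1 := (hδ x (sub hx)).1.hasFDerivAt
    have h2 := (fderiv ℝ f s).hasFDerivAt.comp x hsub
    have h3 := ((H.hasFDerivAt.comp x hsub).clm_apply hsub).const_mul (1 / 2)
    refine ((h1.sub h2).sub h3).congr_fderiv ?_
    ext v
    -- Differentiating the quadratic term gives half of `H (x - s) v + H v (x - s)`; symmetry of `H`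
    -- merges the two halves.
    have := symm v (x - s)
    rw [← hH] at this
    simp only [map_sub, sub_apply] at this
    simp
    linarith
  have bound : ∀ x ∈ Metric.closedBall s ‖y - s‖,
      ‖fderiv ℝ f x - fderiv ℝ f s - H (x - s)‖ ≤ ε * ‖y - s‖ := by
    intro x hx
    refine (hδ x (sub hx)).2.trans ?_
    rw [Metric.mem_closedBall, dist_eq_norm] at hx
    gcongr
  have mv := (convex_closedBall s ‖y - s‖).norm_image_sub_le_of_norm_hasFDerivWithin_le dR bound
    (Metric.mem_closedBall_self (norm_nonneg _)) (y := y)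
    (by rw [Metric.mem_closedBall, dist_eq_norm])
  rw [Real.norm_eq_abs] at mv
  have e : R y - R s = f y - f s - fderiv ℝ f s (y - s) - 1 / 2 * H (y - s) (y - s) := by
    simp [hR]
    ring
  rw [← e]
  exact mv.trans_eq (by ring)

lemma partialDeriv_eq (hs : s ∈ simplexInterior d) (f : (Fin d → ℝ) → ℝ) (i : Fin d) :
    partialDeriv i f s = fderiv ℝ f s (Pi.single i 1) := by
  rw [partialDeriv, fderivWithin_of_mem_nhds (simplex_mem_nhds hs)]

lemma partialDeriv_partialDeriv_eq (hs : s ∈ simplexInterior d) {f : (Fin d → ℝ) → ℝ}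
    (hf : ContDiffAt ℝ 2 f s) (i j : Fin d) :
    partialDeriv i (partialDeriv j f) s =
      fderiv ℝ (fderiv ℝ f) s (Pi.single i 1) (Pi.single j 1) := by
  have d2 : DifferentiableAt ℝ (fderiv ℝ f) s :=
    (hf.fderiv_right (m := 1) (by norm_num)).differentiableAt one_ne_zero
  -- Equality is needed on a neighbourhood, not just at `s`, since both sides are differentiated
  -- again.
  have e : partialDeriv j f =ᶠ[𝓝 s] fun x => fderiv ℝ f x (Pi.single j 1) := by
    filter_upwards [isOpen_simplexInterior.mem_nhds hs] with x hx using partialDeriv_eq hx f j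
  rw [partialDeriv_eq hs, e.fderiv_eq, fderiv_clm_apply d2 (differentiableAt_const _)]
  simp

lemma clm_apply_eq_sum (A : (Fin d → ℝ) →L[ℝ] ℝ) (v : Fin d → ℝ) :
    A v = ∑ i, A (Pi.single i 1) * v i := by
  conv_lhs => rw [pi_eq_sum_univ' v]
  simp [mul_comm]

lemma clm_apply_apply_eq_sum (H : (Fin d → ℝ) →L[ℝ] (Fin d → ℝ) →L[ℝ] ℝ) (v : Fin d → ℝ) :
    H v v = ∑ i, ∑ j, H (Pi.single i 1) (Pi.single j 1) * (v i * v j) := by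
  have h := clm_apply_eq_sum ((ContinuousLinearMap.apply ℝ ℝ v).comp H) v
  simp only [ContinuousLinearMap.comp_apply, ContinuousLinearMap.apply_apply] at h
  rw [h]
  refine Finset.sum_congr rfl fun i _ => ?_
  rw [clm_apply_eq_sum (H (Pi.single i 1)) v, Finset.sum_mul]
  exact Finset.sum_congr rfl fun j _ => by ring

/-- Integrating the Taylor polynomial turns the first and second central moments into the
coefficients of `biasTerm`. The remainder is at most `ε` times squares plus `C_ε` times fourth
powers; after division by `b` the squares stay bounded and the fourth powers vanish. -/
theorem tendsto_inv_mul_integral_kernel_mul_sub_biasTerm (hs : s ∈ simplexInterior d)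
    {f : (Fin d → ℝ) → ℝ} (hf : ContDiffOn ℝ 2 f (simplex d)) :
    Tendsto (fun b => b⁻¹ * ((∫ x in simplex d, kernel b s x * f x) - f s)) (𝓝[>] 0)
      (𝓝 (biasTerm f s)) := by
  have hf2 : ContDiffAt ℝ 2 f s := hf.contDiffAt (simplex_mem_nhds hs)
  set D : Fin d → ℝ := fun i => partialDeriv i f s with hD
  set H : Fin d → Fin d → ℝ := fun i j => partialDeriv i (partialDeriv j f) s with hH
  set r : (Fin d → ℝ) → ℝ := fun x => f x - f s - ∑ i, D i * (x i - s i) -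
    1 / 2 * ∑ i, ∑ j, H i j * ((x i - s i) * (x j - s j)) with hr
  have hfc : ContinuousOn f (simplex d) := hf.continuousOn
  have hrc : ContinuousOn r (simplex d) := by fun_prop
  have rlim : Tendsto (fun b => b⁻¹ * ∫ x in simplex d, kernel b s x * r x) (𝓝[>] 0) (𝓝 0) := by
    refine tendsto_weight_mul_integral_kernel_mul hs (w := fun b => b⁻¹)
      (fun b hb => (inv_pos.2 hb).le) (by fun_prop) (by fun_prop)
      (tendsto_inv_mul_integral_kernel_mul_sum_sq hs)
      (tendsto_inv_mul_integral_kernel_mul_sum_pow_four hs) fun ε ε0 => ?_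
    refine exists_abs_le_add_sum_pow (g := fun x => ε * ∑ i, (x i - s i) ^ 2) hrc
      (fun x => by positivity) ?_ (by decide) (by norm_num)
    filter_upwards [eventually_abs_sub_taylor_two_le hf2 ε0] with x hx
    have e : r x = f x - f s - fderiv ℝ f s (x - s) -
        1 / 2 * fderiv ℝ (fderiv ℝ f) s (x - s) (x - s) := by
      rw [clm_apply_eq_sum, clm_apply_apply_eq_sum]
      simp only [hr, hD, hH, partialDeriv_eq hs, Pi.sub_apply]
      congr 3
      ext i
      congr 1
      ext j
      rw [← partialDeriv_partialDeriv_eq hs hf2, partialDeriv_eq hs]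
    rw [e]
    refine hx.trans ?_
    gcongr
    exact norm_sub_pow_le_sum even_two two_ne_zero x s
  have lim1 := tendsto_finsetSum Finset.univ fun i _ =>
    (tendsto_inv_mul_integral_kernel_mul_sub hs i).const_mul (D i)
  have lim2 := (tendsto_finsetSum Finset.univ fun i _ => tendsto_finsetSum Finset.univ fun j _ =>
    (tendsto_inv_mul_integral_kernel_mul_sub_mul_sub hs i j).const_mul (H i j)).const_mul (1 / 2)
  have lim := (lim1.add lim2).add rlim
  have eb : ∑ i, D i * (1 - ((d : ℝ) + 1) * s i) +
      1 / 2 * ∑ i, ∑ j, H i j * (s i * ((if i = j then 1 else 0) - s j)) + 0 = biasTerm f s := by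
    rw [biasTerm, add_zero]
    simp only [mul_comm]
    rfl
  rw [eb] at lim
  refine lim.congr' ?_
  filter_upwards [self_mem_nhdsWithin] with b hb
  have hb' : 0 < b := hb
  rw [← integral_kernel_mul_sub_const hs hb' hfc]
  have e : ∀ x, kernel b s x * (f x - f s) = kernel b s x * ∑ i, D i * (x i - s i) +
      1 / 2 * (kernel b s x * ∑ i, ∑ j, H i j * ((x i - s i) * (x j - s j))) +
        kernel b s x * r x := by
    intro x; simp only [hr]; ring
  have j1 := integrableOn_kernel_mul hs hb' (h := fun x => ∑ i, D i * (x i - s i)) (by fun_prop)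
  have j2 := (integrableOn_kernel_mul hs hb' (h := fun x => ∑ i, ∑ j, H i j *
    ((x i - s i) * (x j - s j))) (by fun_prop)).const_mul (1 / 2)
  have j3 := integrableOn_kernel_mul hs hb' hrc
  simp_rw [e]
  rw [integral_add, integral_add j1 j2, integral_const_mul,
    integral_kernel_mul_sum _ hs hb' fun i => by fun_prop,
    integral_kernel_mul_sum _ hs hb' fun i => by fun_prop]
  · have k2 : ∀ i, ∫ x in simplex d, kernel b s x * ∑ j, H i j * ((x i - s i) * (x j - s j)) =
        ∑ j, H i j * ∫ x in simplex d, kernel b s x * ((x i - s i) * (x j - s j)) := by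
      intro i
      rw [integral_kernel_mul_sum _ hs hb' fun j => by fun_prop]
      refine Finset.sum_congr rfl fun j _ => ?_
      rw [← integral_const_mul]
      simp_rw [mul_left_comm]
    have k1 : ∀ i, ∫ x in simplex d, kernel b s x * (D i * (x i - s i)) =
        D i * ∫ x in simplex d, kernel b s x * (x i - s i) := by
      intro i
      rw [← integral_const_mul]
      simp_rw [mul_left_comm]
    simp_rw [k1, k2, mul_add, Finset.mul_sum]
    congr 2
    · refine Finset.sum_congr rfl fun i _ => by ring
    · refine Finset.sum_congr rfl fun i _ => Finset.sum_congr rfl fun j _ => by ring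
  · exact j1.add j2
  · exact j3

variable {f : (Fin d → ℝ) → ℝ}

/-! ### Moments of the kernel evaluated at an observation -/

lemma measurable_kernel (b : ℝ) (s : Fin d → ℝ) : Measurable (kernel b s) := by
  have := (continuous_l1Norm (d := d)).measurable
  unfold kernel dirichletDensity
  fun_prop

lemma ae_mem_simplex_lawOfDensity (f : (Fin d → ℝ) → ℝ) :
    ∀ᵐ x ∂lawOfDensity f, x ∈ simplex d :=
  (withDensity_absolutelyContinuous _ _).ae_le (ae_restrict_mem measurableSet_simplex)

lemma integral_lawOfDensity (hf : ∀ x ∈ simplex d, 0 ≤ f x) (hfc : ContinuousOn f (simplex d))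
    (g : (Fin d → ℝ) → ℝ) :
    ∫ x, g x ∂lawOfDensity f = ∫ x in simplex d, g x * f x := by
  rw [lawOfDensity, integral_withDensity_eq_integral_toReal_smul₀
    (hfc.aemeasurable measurableSet_simplex).ennreal_ofReal
    (ae_of_all _ fun x => ENNReal.ofReal_lt_top)]
  refine setIntegral_congr_fun measurableSet_simplex fun x hx => ?_
  simp [ENNReal.toReal_ofReal (hf x hx), mul_comm]

lemma tendsto_sqrt_pow_mul_integral_kernel_sq_mul (hs : s ∈ simplexInterior d)
    (hfc : ContinuousOn f (simplex d)) :
    Tendsto (fun b => √b ^ d * ∫ x in simplex d, kernel b s x ^ 2 * f x) (𝓝[>] 0)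
      (𝓝 (psi s * f s)) := by
  have half : Tendsto (fun b : ℝ => b / 2) (𝓝[>] 0) (𝓝[>] 0) := by
    refine tendsto_nhdsWithin_iff.2 ⟨tendsto_nhdsWithin_of_tendsto_nhds ?_, ?_⟩
    · have : Continuous fun b : ℝ => b / 2 := by fun_prop
      simpa using this.tendsto 0
    · filter_upwards [self_mem_nhdsWithin] with b hb using half_pos (Set.mem_Ioi.1 hb)
  refine ((tendsto_sqrt_pow_mul_sqConst hs).mul
    ((tendsto_integral_kernel_mul hs hfc).comp half)).congr' ?_
  filter_upwards [self_mem_nhdsWithin] with b hb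
  rw [mul_assoc, Function.comp, ← integral_const_mul]
  congr 1
  refine setIntegral_congr_fun measurableSet_simplex fun x hx => ?_
  rw [kernel_sq hs hb hx]
  ring

/-- Two squarings reduce `K_b⁴` to `A_b² K_{b/2}²`; the factor `√2^d` comes from passing between
`√b` and `√(b/2)`. Only the finiteness of the limit matters later. -/
lemma tendsto_sqrt_pow_mul_integral_kernel_pow_four_mul (hs : s ∈ simplexInterior d)
    (hfc : ContinuousOn f (simplex d)) :
    Tendsto (fun b => (√b ^ d) ^ 3 * ∫ x in simplex d, kernel b s x ^ 4 * f x) (𝓝[>] 0)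
      (𝓝 (psi s ^ 2 * (√2 ^ d * (psi s * f s)))) := by
  have half : Tendsto (fun b : ℝ => b / 2) (𝓝[>] 0) (𝓝[>] 0) := by
    refine tendsto_nhdsWithin_iff.2 ⟨tendsto_nhdsWithin_of_tendsto_nhds ?_, ?_⟩
    · have : Continuous fun b : ℝ => b / 2 := by fun_prop
      simpa using this.tendsto 0
    · filter_upwards [self_mem_nhdsWithin] with b hb using half_pos (Set.mem_Ioi.1 hb)
  refine (((tendsto_sqrt_pow_mul_sqConst hs).pow 2).mul
    (((tendsto_sqrt_pow_mul_integral_kernel_sq_mul hs hfc).comp half).const_mul (√2 ^ d))).congr' ?_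
  filter_upwards [self_mem_nhdsWithin] with b hb
  have e : ∫ x in simplex d, kernel b s x ^ 4 * f x =
      sqConst b s ^ 2 * ∫ x in simplex d, kernel (b / 2) s x ^ 2 * f x := by
    rw [← integral_const_mul]
    refine setIntegral_congr_fun measurableSet_simplex fun x hx => ?_
    have : kernel b s x ^ 4 = (kernel b s x ^ 2) ^ 2 := by ring
    rw [this, kernel_sq hs hb hx]
    ring
  have e2 : √2 ^ d * √(b / 2) ^ d = √b ^ d := by
    rw [← mul_pow, ← Real.sqrt_mul (by norm_num), mul_div_cancel₀ _ two_ne_zero]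
  rw [e, Function.comp, ← e2]
  ring

lemma add_pow_four_le (a c : ℝ) : (a - c) ^ 4 ≤ 8 * (a ^ 4 + c ^ 4) := by
  nlinarith [sq_nonneg (a ^ 2 - c ^ 2), sq_nonneg (a + c), sq_nonneg ((a + c) ^ 2),
    sq_nonneg (a ^ 2 + c ^ 2), mul_nonneg (sq_nonneg (a + c)) (sq_nonneg (a - c)),
    mul_nonneg (sq_nonneg (a + c)) (add_nonneg (sq_nonneg a) (sq_nonneg c))]

section Estimator

variable {Ω : Type*} [MeasurableSpace Ω] {P : Measure Ω} [IsProbabilityMeasure P]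
  {X : ℕ → Ω → Fin d → ℝ}

lemma memLp_kernel_sub [IsProbabilityMeasure (lawOfDensity f)] (hs : s ∈ simplexInterior d)
    {b : ℝ} (hb : 0 < b) (c : ℝ) (p : ENNReal) :
    MemLp (fun x => kernel b s x - c) p (lawOfDensity f) := by
  obtain ⟨B, hB⟩ := isCompact_simplex.exists_bound_of_continuousOn
    ((continuous_kernel hs hb).sub (continuous_const (y := c))).continuousOn
  refine MemLp.of_bound ((measurable_kernel b s).sub_const c).aestronglyMeasurable B ?_
  filter_upwards [ae_mem_simplex_lawOfDensity f] with x hx using hB x hx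

lemma integral_estimator (hs : s ∈ simplexInterior d) (hf : ∀ x ∈ simplex d, 0 ≤ f x)
    (hfc : ContinuousOn f (simplex d)) (hlaw : ∀ i, HasLaw (X i) (lawOfDensity f) P)
    {n : ℕ} (hn : 1 ≤ n) {b : ℝ} (hb : 0 < b) :
    ∫ ω, estimator X n b s ω ∂P = ∫ x in simplex d, kernel b s x * f x := by
  have : IsProbabilityMeasure (lawOfDensity f) := (hlaw 0).isProbabilityMeasure_iff.1 inferInstance
  have i1 : Integrable (kernel b s) (lawOfDensity f) := by
    simpa using (memLp_kernel_sub hs hb 0 1).integrable le_rfl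
  have one : ∀ i, ∫ ω, kernel b s (X i ω) ∂P = ∫ x in simplex d, kernel b s x * f x := by
    intro i
    rw [← integral_lawOfDensity hf hfc, ← (hlaw i).map_eq,
      integral_map (hlaw i).aemeasurable (measurable_kernel b s).aestronglyMeasurable]
  unfold estimator
  rw [integral_const_mul, integral_finsetSum]
  · simp_rw [one]
    have : (n : ℝ) ≠ 0 := by positivity
    simp [this]
  · intro i _
    have h := i1
    rw [← (hlaw i).map_eq] at h
    exact h.comp_aemeasurable (hlaw i).aemeasurable

/-- The common form of the three claims, for scaling `r n` and centring `c n`. The summands are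
`(r/n)(K_b(X_i) - e_n)` with `e_n` the mean, and the scaled bias `r(e_n - c)` becomes the shift. -/
theorem tendstoInDistribution_estimator (hd : 1 ≤ d) (hs : s ∈ simplexInterior d)
    (hf : ∀ x ∈ simplex d, 0 ≤ f x) (hfc : ContinuousOn f (simplex d))
    (hindep : iIndepFun X P) (hlaw : ∀ i, HasLaw (X i) (lawOfDensity f) P)
    {b r c : ℕ → ℝ} (hb : ∀ n, 1 ≤ n → 0 < b n) (hb0 : Tendsto b atTop (𝓝 0))
    (hnb : Tendsto (fun n : ℕ => n * √(b n) ^ d) atTop atTop) {τ m : ℝ}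
    (hr : Tendsto (fun n : ℕ => r n ^ 2 / (n * √(b n) ^ d)) atTop (𝓝 τ))
    (hm : Tendsto (fun n => r n * ((∫ x in simplex d, kernel (b n) s x * f x) - c n)) atTop
      (𝓝 m)) :
    TendstoInDistribution (fun n ω => r n * (estimator X n (b n) s ω - c n)) atTop
      (id : ℝ → ℝ) (fun _ => P) (gaussianReal m (τ * (psi s * f s)).toNNReal) := by
  have prob : IsProbabilityMeasure (lawOfDensity f) :=
    (hlaw 0).isProbabilityMeasure_iff.1 inferInstance
  have bpos : ∀ᶠ n in atTop, 0 < b n := (eventually_ge_atTop 1).mono hb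
  have hbw : Tendsto b atTop (𝓝[>] 0) := tendsto_nhdsWithin_iff.2 ⟨hb0, bpos⟩
  set e : ℕ → ℝ := fun n => ∫ x in simplex d, kernel (b n) s x * f x with he
  set W : ℕ → ℝ := fun n => √(b n) ^ d with hW
  set g : ℕ → (Fin d → ℝ) → ℝ := fun n x => r n / n * (kernel (b n) s x - e n) with hg
  have wpos : ∀ᶠ n in atTop, 0 < W n := bpos.mono fun n hn => pow_pos (Real.sqrt_pos.2 hn) d
  have elim : Tendsto e atTop (𝓝 (f s)) := (tendsto_integral_kernel_mul hs hfc).comp hbw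
  -- This needs `d ≥ 1`; it makes the squared mean negligible beside `∫ K_b² f`.
  have Wlim : Tendsto W atTop (𝓝 0) := by
    have h : Continuous fun b : ℝ => √b ^ d := by fun_prop
    have h0 := (h.tendsto 0).comp hb0
    simpa [Function.comp_def, (by lia : d ≠ 0)] using h0
  have kint : ∀ n, 0 < b n → ∀ k : ℕ, Integrable (fun x => kernel (b n) s x ^ k)
      (lawOfDensity f) := by
    intro n hn k
    rcases Nat.eq_zero_or_pos k with rfl | hk
    · simp
    have h := (memLp_kernel_sub (f := f) hs hn 0 k).integrable_norm_pow hk.ne'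
    refine h.congr ?_
    filter_upwards [ae_mem_simplex_lawOfDensity f] with x hx
    rw [sub_zero, Real.norm_of_nonneg (kernel_nonneg hs hn hx)]
  have eint : ∀ n, ∫ x, kernel (b n) s x ∂lawOfDensity f = e n := fun n =>
    integral_lawOfDensity hf hfc _
  have key := tendstoInDistribution_sum_add hindep hlaw (g := g) (v := τ * (psi s * f s))
    -- The two sequences must agree for every `n`, and at `n = 0` the estimator is 0 by the
    -- convention on division by zero.
    (m := fun n => r n * ((if n = 0 then 0 else e n) - c n)) (m₀ := m)
    (fun n => ((measurable_kernel _ _).sub_const _).const_mul _) ?_ ?_ ?_ ?_ ?_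
  · convert key using 3 with n ω
    rcases Nat.eq_zero_or_pos n with rfl | hn
    · simp [estimator]
    · have : (n : ℝ) ≠ 0 := by positivity
      simp only [hg, estimator, hn.ne', if_false, ← Finset.mul_sum, Finset.sum_sub_distrib,
        Finset.sum_const, Finset.card_range, nsmul_eq_mul]
      field_simp
      ring
  · filter_upwards [bpos] with n hn
    have k1 : Integrable (fun x => kernel (b n) s x) (lawOfDensity f) := by
      simpa using kint n hn 1
    simp only [hg]
    rw [integral_const_mul, integral_sub k1 (integrable_const _), eint]
    simp
  · filter_upwards [bpos] with n hn using (memLp_kernel_sub hs hn _ _).const_mul _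
  · have lim := hr.mul (((tendsto_sqrt_pow_mul_integral_kernel_sq_mul hs hfc).comp hbw).sub
      (Wlim.mul (elim.pow 2)))
    rw [zero_mul, sub_zero] at lim
    refine lim.congr' ?_
    filter_upwards [bpos, wpos, eventually_gt_atTop 0] with n hn hw hn0
    have k1 : Integrable (fun x => kernel (b n) s x) (lawOfDensity f) := by
      simpa using kint n hn 1
    have n0 : (n : ℝ) ≠ 0 := by positivity
    have e1 : ∀ x, g n x ^ 2 = (r n / n) ^ 2 *
        (kernel (b n) s x ^ 2 - (2 * e n * kernel (b n) s x - e n ^ 2)) := by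
      intro x; simp only [hg]; ring
    simp_rw [e1]
    have k2 : Integrable (fun x => 2 * e n * kernel (b n) s x - e n ^ 2) (lawOfDensity f) :=
      (k1.const_mul _).sub (integrable_const _)
    rw [integral_const_mul, integral_sub (kint n hn 2) k2,
      integral_sub (k1.const_mul _) (integrable_const _), integral_const_mul, eint,
      integral_lawOfDensity hf hfc]
    simp only [Function.comp, integral_const, probReal_univ, one_smul]
    change r n ^ 2 / (n * W n) * (W n * _ - W n * e n ^ 2) = _
    field_simp
    ring
  -- With `W = b^(d/2)`, the quantity is bounded by `(r²/(nW))² · (nW)⁻¹` times a convergent factor,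
  -- and `nW → ∞`.
  · have lim4 := (tendsto_sqrt_pow_mul_integral_kernel_pow_four_mul hs hfc).comp hbw
    have lim := (hr.pow 2).mul ((tendsto_inv_atTop_zero.comp hnb).mul
      ((lim4.add ((Wlim.pow 3).mul (elim.pow 4))).const_mul 8))
    rw [zero_mul, mul_zero] at lim
    refine squeeze_zero' (Eventually.of_forall fun n => by positivity) ?_ lim
    filter_upwards [bpos, wpos, eventually_gt_atTop 0] with n hn hw hn0
    have n0 : (0 : ℝ) < n := by positivity
    have i4 : ∫ x, g n x ^ 4 ∂lawOfDensity f ≤ (r n / n) ^ 4 *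
        (8 * ((∫ x in simplex d, kernel (b n) s x ^ 4 * f x) + e n ^ 4)) := by
      have e2 : ∫ x, (r n / n) ^ 4 * (8 * (kernel (b n) s x ^ 4 + e n ^ 4)) ∂lawOfDensity f =
          (r n / n) ^ 4 *
            (8 * ((∫ x in simplex d, kernel (b n) s x ^ 4 * f x) + e n ^ 4)) := by
        rw [integral_const_mul, integral_const_mul, integral_add (kint n hn 4)
          (integrable_const _), integral_lawOfDensity hf hfc]
        simp
      rw [← e2]
      refine integral_mono_of_nonneg (ae_of_all _ fun x => by positivity)
        ((((kint n hn 4).add (integrable_const _)).const_mul _).const_mul _)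
        (ae_of_all _ fun x => ?_)
      simp only [hg]
      rw [mul_pow]
      exact mul_le_mul_of_nonneg_left (add_pow_four_le _ _) (by positivity)
    refine (mul_le_mul_of_nonneg_left i4 n0.le).trans_eq ?_
    simp only [Function.comp]
    change _ = (r n ^ 2 / (n * W n)) ^ 2 * ((n * W n)⁻¹ * (8 * (W n ^ 3 * _ + W n ^ 3 * e n ^ 4)))
    field_simp
  · refine hm.congr' ?_
    filter_upwards [eventually_gt_atTop 0] with n hn
    simp [he, hn.ne']

end Estimator

/-! ### Bookkeeping of exponents for the normalising rates -/

lemma sqrt_pow_eq_rpow {b : ℝ} (hb : 0 ≤ b) (d : ℕ) : √b ^ d = b ^ ((d : ℝ) / 2) := by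
  rw [Real.sqrt_eq_rpow, ← Real.rpow_mul_natCast hb]
  ring_nf

lemma rpow_half_mul_rpow_quarter_sq {x b : ℝ} (hx : 0 ≤ x) (hb : 0 ≤ b) (d : ℕ) :
    (x ^ (1 / 2 : ℝ) * b ^ ((d : ℝ) / 4)) ^ 2 = x * √b ^ d := by
  rw [mul_pow, ← Real.rpow_mul_natCast hx, ← Real.rpow_mul_natCast hb, sqrt_pow_eq_rpow hb]
  norm_num
  left
  ring_nf

/-- The exponents match because `4/(d+4) - 1 = (2/(d+4)) · (-d/2)`. This is the source of `λ^(-d/2)`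
in the third variance. -/
lemma rpow_two_div_sq_div {x b : ℝ} (hx : 0 < x) (hb : 0 < b) (d : ℕ) :
    (x ^ (2 / ((d : ℝ) + 4))) ^ 2 / (x * √b ^ d) =
      (x ^ (2 / ((d : ℝ) + 4)) * b) ^ (-(d : ℝ) / 2) := by
  have hd : (d : ℝ) + 4 ≠ 0 := by positivity
  rw [Real.mul_rpow (by positivity) hb.le, ← Real.rpow_mul_natCast hx.le, ← Real.rpow_mul hx.le,
    sqrt_pow_eq_rpow hb.le, neg_div, Real.rpow_neg hb.le, div_mul_eq_div_div,
    ← Real.rpow_sub_one hx.ne', div_eq_mul_inv]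
  congr 2
  push_cast
  field_simp
  ring

end DirichletKernel

/-! ### The three limit theorems -/

open DirichletKernel in
theorem mainTheorem4 {d : ℕ} (hd : 1 ≤ d)
    {Ω : Type*} [MeasurableSpace Ω] (P : Measure Ω) [IsProbabilityMeasure P]
    (f : (Fin d → ℝ) → ℝ) (hf : ∀ x ∈ DirichletKernel.simplex d, 0 ≤ f x)
    (X : ℕ → Ω → Fin d → ℝ) (hindep : iIndepFun X P)
    (hlaw : ∀ i, HasLaw (X i) (DirichletKernel.lawOfDensity f) P)
    (b : ℕ → ℝ) (hb : ∀ n, 1 ≤ n → 0 < b n)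
    (s : Fin d → ℝ) (hs : s ∈ DirichletKernel.simplexInterior d) (hfs : 0 < f s) :
    ((∃ L, LipschitzOnWith L f (DirichletKernel.simplex d)) →
      Tendsto b atTop (𝓝 0) →
      Tendsto (fun n : ℕ => (n : ℝ) ^ (1 / 2 : ℝ) * b n ^ ((d : ℝ) / 4)) atTop atTop →
        TendstoInDistribution
          (fun (n : ℕ) ω => (n : ℝ) ^ (1 / 2 : ℝ) * b n ^ ((d : ℝ) / 4) *
            (DirichletKernel.estimator X n (b n) s ω -
              ∫ ω', DirichletKernel.estimator X n (b n) s ω' ∂P))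
          atTop (id : ℝ → ℝ) (fun _ => P)
          (gaussianReal 0 (DirichletKernel.psi s * f s).toNNReal) ∧
        (Tendsto (fun n : ℕ => (n : ℝ) ^ (1 / 2 : ℝ) * b n ^ ((d : ℝ) / 4 + 1 / 2))
            atTop (𝓝 0) →
          TendstoInDistribution
            (fun (n : ℕ) ω => (n : ℝ) ^ (1 / 2 : ℝ) * b n ^ ((d : ℝ) / 4) *
              (DirichletKernel.estimator X n (b n) s ω - f s))
            atTop (id : ℝ → ℝ) (fun _ => P)
            (gaussianReal 0 (DirichletKernel.psi s * f s).toNNReal))) ∧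
    (ContDiffOn ℝ 2 f (DirichletKernel.simplex d) →
      ∀ lam : ℝ, 0 < lam →
        Tendsto (fun n : ℕ => (n : ℝ) ^ (2 / ((d : ℝ) + 4)) * b n) atTop (𝓝 lam) →
        TendstoInDistribution
          (fun (n : ℕ) ω => (n : ℝ) ^ (2 / ((d : ℝ) + 4)) *
            (DirichletKernel.estimator X n (b n) s ω - f s))
          atTop (id : ℝ → ℝ) (fun _ => P)
          (gaussianReal (lam * DirichletKernel.biasTerm f s)
            (lam ^ (-(d : ℝ) / 2) * (DirichletKernel.psi s * f s)).toNNReal)) := by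
  have pos : ∀ᶠ n : ℕ in atTop, 0 < (n : ℝ) ∧ 0 < b n := by
    filter_upwards [eventually_ge_atTop 1] with n hn
    exact ⟨by positivity, hb n hn⟩
  refine ⟨fun ⟨L, hL⟩ hb0 hrate => ?_, fun hC lam hlam hrate => ?_⟩
  · have hfc : ContinuousOn f (simplex d) := hL.continuousOn
    have hbw : Tendsto b atTop (𝓝[>] 0) :=
      tendsto_nhdsWithin_iff.2 ⟨hb0, pos.mono fun n hn => hn.2⟩
    have hnb : Tendsto (fun n : ℕ => n * √(b n) ^ d) atTop atTop := by
      refine ((tendsto_pow_atTop two_ne_zero).comp hrate).congr' ?_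
      filter_upwards [pos] with n hn using rpow_half_mul_rpow_quarter_sq hn.1.le hn.2.le d
    have hr : Tendsto (fun n : ℕ => ((n : ℝ) ^ (1 / 2 : ℝ) * b n ^ ((d : ℝ) / 4)) ^ 2 /
        (n * √(b n) ^ d)) atTop (𝓝 1) := by
      refine tendsto_const_nhds.congr' ?_
      filter_upwards [pos] with n hn
      rw [rpow_half_mul_rpow_quarter_sq hn.1.le hn.2.le d, div_self]
      exact (mul_pos hn.1 (pow_pos (Real.sqrt_pos.2 hn.2) d)).ne'
    refine ⟨?_, fun hbias => ?_⟩
    · have h := tendstoInDistribution_estimator hd hs hf hfc hindep hlaw hb hb0 hnb hr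
        (c := fun n => ∫ ω', estimator X n (b n) s ω' ∂P) (m := 0) ?_
      · simpa only [one_mul] using h
      · refine tendsto_const_nhds.congr' ?_
        filter_upwards [eventually_ge_atTop 1] with n hn
        rw [integral_estimator hs hf hfc hlaw hn (hb n hn), sub_self, mul_zero]
    · have h := tendstoInDistribution_estimator hd hs hf hfc hindep hlaw hb hb0 hnb hr
        (c := fun _ => f s) (m := 0) ?_
      · simpa only [one_mul] using h
      · obtain ⟨C, hC⟩ := exists_abs_integral_kernel_mul_sub_le hs hL
        have lim := hbias.const_mul C
        rw [mul_zero] at lim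
        refine squeeze_zero_norm' ?_ lim
        filter_upwards [pos, hbw.eventually hC] with n hn hCn
        have p : 0 ≤ (n : ℝ) ^ (1 / 2 : ℝ) * b n ^ ((d : ℝ) / 4) :=
          mul_nonneg (Real.rpow_nonneg hn.1.le _) (Real.rpow_nonneg hn.2.le _)
        rw [Real.norm_eq_abs, abs_mul, abs_of_nonneg p, Real.rpow_add hn.2, ← Real.sqrt_eq_rpow (b n)]
        calc _ ≤ (n : ℝ) ^ (1 / 2 : ℝ) * b n ^ ((d : ℝ) / 4) * (C * √(b n)) := by gcongr
          _ = _ := by ring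
  · have hfc : ContinuousOn f (simplex d) := hC.continuousOn
    have hd4 : (0 : ℝ) < 2 / ((d : ℝ) + 4) := by positivity
    have hρ : Tendsto (fun n : ℕ => (n : ℝ) ^ (2 / ((d : ℝ) + 4))) atTop atTop :=
      (tendsto_rpow_atTop hd4).comp tendsto_natCast_atTop_atTop
    have hb0 : Tendsto b atTop (𝓝 0) := by
      -- Here `b` is the product of `n^(2/(d+4)) b`, which converges, and `n^(-2/(d+4))`, which
      -- vanishes.
      have := hrate.mul (tendsto_inv_atTop_zero.comp hρ)
      rw [mul_zero] at this
      refine this.congr' ?_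
      filter_upwards [pos] with n hn
      have : (n : ℝ) ^ (2 / ((d : ℝ) + 4)) ≠ 0 := (Real.rpow_pos_of_pos hn.1 _).ne'
      simp only [Function.comp]
      field_simp
    have hbw : Tendsto b atTop (𝓝[>] 0) :=
      tendsto_nhdsWithin_iff.2 ⟨hb0, pos.mono fun n hn => hn.2⟩
    have hr : Tendsto (fun n : ℕ => ((n : ℝ) ^ (2 / ((d : ℝ) + 4))) ^ 2 / (n * √(b n) ^ d)) atTop
        (𝓝 (lam ^ (-(d : ℝ) / 2))) := by
      refine (hrate.rpow_const (Or.inl hlam.ne')).congr' ?_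
      filter_upwards [pos] with n hn using (rpow_two_div_sq_div hn.1 hn.2 d).symm
    have hnb : Tendsto (fun n : ℕ => n * √(b n) ^ d) atTop atTop := by
      -- Write `n b^(d/2)` as `r²` divided by `r²/(n b^(d/2))`: the numerator diverges and the
      -- denominator tends to `λ^(-d/2) > 0`.
      refine (((tendsto_pow_atTop two_ne_zero).comp hρ).atTop_mul_pos
        (inv_pos.2 (Real.rpow_pos_of_pos hlam _)) (hr.inv₀
          (Real.rpow_pos_of_pos hlam _).ne')).congr' ?_
      filter_upwards [pos] with n hn
      have : (n : ℝ) ^ (2 / ((d : ℝ) + 4)) ≠ 0 := (Real.rpow_pos_of_pos hn.1 _).ne'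
      simp only [Function.comp, inv_div]
      field_simp
    refine tendstoInDistribution_estimator hd hs hf hfc hindep hlaw hb hb0 hnb hr
      (c := fun _ => f s) ?_
    -- The scaled bias is `n^(2/(d+4)) b`, with limit `λ`, times the bias divided by `b`, with limit
    -- `g(s)`.
    refine (hrate.mul
      ((tendsto_inv_mul_integral_kernel_mul_sub_biasTerm hs hC).comp hbw)).congr' ?_
    filter_upwards [pos] with n hn
    simp only [Function.comp]
    rw [mul_assoc, mul_inv_cancel_left₀ hn.2.ne']
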